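/- Let $\zeta$ be the Riemann zeta-function and write $s=\sigma+it$. There is an absolute constant $T_0>0$ such that for every real $T>T_0$ and every real $A>0.17$ there is a radius $r$ with $$\exp(-T^{A})\le r\le \exp(-T^{A-0.17})$$ such that in the region $$\{s\in\mathbb C : |s-(1/2+iT)|\le r \text{ and } \sigma<1/2\}$$ the functions $\zeta(s)$ and $\zeta'(s)$ have the same (finite) number of zeros, counted with multiplicity. -/

import Mathlib

/-- The set `{s : |s - (1/2 + iT)| ≤ r and Re s < 1/2}`: the part of a closed disc centred at
`1/2 + iT` that lies strictly to the left of the critical line. -/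
def leftHalfDisc (T r : ℝ) : Set ℂ :=
  {s : ℂ | ‖s - (1 / 2 + Complex.I * (T : ℂ))‖ ≤ r ∧ s.re < 1 / 2}

/-- The set of zeros of `f` in `R`. -/
def zerosIn (f : ℂ → ℂ) (R : Set ℂ) : Set ℂ := {s : ℂ | s ∈ R ∧ f s = 0}

/-- The number of zeros of `f` in `R`, counted with multiplicity (order of vanishing). It is
meaningful when `zerosIn f R` is finite and `f` is analytic and not locally zero at these points. -/
noncomputable def zeroCount (f : ℂ → ℂ) (R : Set ℂ) : ℕ :=
  ∑ᶠ s ∈ zerosIn f R, analyticOrderNatAt f s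

/-! Re (ζ'/ζ) is negative on the boundary of a suitable rectangle just to the left of the critical
line, so −ζ'/ζ has an analytic logarithm there and the argument principle gives ζ and ζ' equally
many zeros inside (`zeroCount_eq_of_re_div_neg`). `zeroCount_leftHalfDisc_eq` passes from the
rectangle to the half-disc.

Near s₀ = 1/2 + iT write ζ'/ζ = ∑ m(a)/(s − a) + Q, where a runs over the zeros within 1/1000 of s₀
and Q has Lipschitz constant O(log T). These zeros are symmetric about the line, so the sum is
purely imaginary on it. The functional equation and the growth of Γ give Re (ζ'/ζ) ≤ −1 on the line
(`exists_re_logDeriv_riemannZeta_le`), hence Re Q ≤ −1 there, and this survives up to a small error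
slightly to the left. To the left of the line, a zero together with its mirror image contributes a
nonpositive real part at every s outside the disc having the pair as diameter. This covers zeros on
the line and zeros much closer to s₀ than s is; zeros much farther away contribute little. It
remains to find r such that no off-line zero has distance between r/3 and T√r from s₀
(`re_logDeriv_neg_of_annulus`).

With r = exp(−L), an off-line pair at distance exp(−x) spoils roughly the L in [x, 2x], so N pairs
can force L up by a factor of about 2^N (`exists_scale_avoiding`). Jensen's formula on the unit
circle about 1.001 + iT, with |ζ| at most about T^max(1 − σ, 0), allows about log T/(π log 2) zeros
near s₀ (`exists_sum_order_le_near`). Mirror pairing halves this, so 2^N is about T^(1/(2π)), and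
1/(2π) = 0.159... leaves room below 0.17. -/

open Set Filter Topology Metric

/-! ### Factoring out zeros of analytic functions. -/

/-- Dividing out a zero of finite order. -/
theorem exists_eq_sub_pow_mul {f : ℂ → ℂ} {U : Set ℂ}
    (hf : AnalyticOnNhd ℂ f U) {a : ℂ} (ha : a ∈ U) (hfin : analyticOrderAt f a ≠ ⊤) :
    ∃ g : ℂ → ℂ, AnalyticOnNhd ℂ g U ∧ g a ≠ 0 ∧
      ∀ z, f z = (z - a) ^ analyticOrderNatAt f a * g z := by
  obtain ⟨h, hh, hha, he⟩ := (hf a ha).analyticOrderAt_ne_top.1 hfin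
  set n := analyticOrderNatAt f a
  classical
  -- Away from `a` the quotient is literal, so the factorisation holds at every point, even outside
  -- `U`; the local factor `h` is needed only to repair the value at `a`.
  refine ⟨Function.update (fun z => f z / (z - a) ^ n) a (h a), ?_, ?_, ?_⟩
  · intro z hz
    by_cases hza : z = a
    · subst hza
      refine hh.congr ?_
      filter_upwards [he] with w hw
      by_cases hwz : w = z
      · subst hwz; simp
      · have : w - z ≠ 0 := sub_ne_zero.2 hwz
        rw [Function.update_of_ne hwz, hw]
        simp only [smul_eq_mul]
        field_simp
    · have h1 : AnalyticAt ℂ (fun w => f w / (w - a) ^ n) z :=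
        (hf z hz).div ((analyticAt_id.sub analyticAt_const).pow n)
          (pow_ne_zero _ (sub_ne_zero.2 hza))
      refine h1.congr ?_
      filter_upwards [isOpen_compl_singleton.mem_nhds (show z ∈ ({a} : Set ℂ)ᶜ from hza)] with w hw
      rw [Function.update_of_ne hw]
  · simpa using hha
  · intro z
    by_cases hza : z = a
    · subst hza
      simpa using he.self_of_nhds
    · have : z - a ≠ 0 := sub_ne_zero.2 hza
      rw [Function.update_of_ne hza]
      field_simp

/-- Dividing out finitely many zeros of finite order. -/
theorem exists_eq_prod_mul {f : ℂ → ℂ} {U : Set ℂ}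
    (hf : AnalyticOnNhd ℂ f U) (hfin : ∀ z ∈ U, analyticOrderAt f z ≠ ⊤) (Z : Finset ℂ)
    (hZ : ∀ a ∈ Z, a ∈ U) :
    ∃ g : ℂ → ℂ, AnalyticOnNhd ℂ g U ∧ (∀ a ∈ Z, g a ≠ 0) ∧
      ∀ z, f z = (∏ a ∈ Z, (z - a) ^ analyticOrderNatAt f a) * g z := by
  classical
  induction Z using Finset.induction_on with
  | empty => exact ⟨f, hf, by simp, by simp⟩
  | insert a Z haZ ih =>
    obtain ⟨g, hg, hgZ, hfg⟩ := ih fun b hb => hZ b (Finset.mem_insert_of_mem hb)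
    have haU : a ∈ U := hZ a (Finset.mem_insert_self a Z)
    have hp : AnalyticAt ℂ (fun z => ∏ b ∈ Z, (z - b) ^ analyticOrderNatAt f b) a := by
      fun_prop
    have hpa : (∏ b ∈ Z, (a - b) ^ analyticOrderNatAt f b) ≠ 0 := by
      refine Finset.prod_ne_zero_iff.2 fun b hb => pow_ne_zero _ (sub_ne_zero.2 ?_)
      rintro rfl; exact haZ hb
    have hord : analyticOrderAt f a = analyticOrderAt g a := by
      have h1 : f = (fun z => ∏ b ∈ Z, (z - b) ^ analyticOrderNatAt f b) * g := by
        funext z; exact hfg z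
      conv_lhs => rw [h1]
      rw [analyticOrderAt_mul hp (hg a haU), hp.analyticOrderAt_eq_zero.2 hpa, zero_add]
    have hordN : analyticOrderNatAt g a = analyticOrderNatAt f a := by
      simp only [analyticOrderNatAt, hord]
    obtain ⟨k, hk, hka, hgk⟩ := exists_eq_sub_pow_mul hg haU (hord ▸ hfin a haU)
    refine ⟨k, hk, ?_, ?_⟩
    · intro b hb
      rcases Finset.mem_insert.1 hb with rfl | hb
      · exact hka
      · intro h0
        exact hgZ b hb (by rw [hgk b, h0, mul_zero])
    · intro z
      rw [Finset.prod_insert haZ, hfg z, hgk z, hordN]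
      ring

theorem finite_zeros_of_isCompact {f : ℂ → ℂ} {U K : Set ℂ}
    (hf : AnalyticOnNhd ℂ f U) (hfin : ∀ z ∈ U, analyticOrderAt f z ≠ ⊤)
    (hK : IsCompact K) (hKU : K ⊆ U) : {z | z ∈ K ∧ f z = 0}.Finite := by
  by_contra hinf
  obtain ⟨x, hxK, hx⟩ := Set.Infinite.exists_accPt_of_subset_isCompact hinf hK (fun z hz => hz.1)
  have h1 : ∃ᶠ z in 𝓝[≠] x, f z = 0 :=
    (accPt_iff_frequently_nhdsNE.1 hx).mono fun z hz => hz.2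
  have h2 := (hf x (hKU hxK)).frequently_zero_iff_eventually_zero.1 h1
  exact hfin x (hKU hxK) (analyticOrderAt_eq_top.2 h2)

theorem logDeriv_prod_sub_pow {Z : Finset ℂ} {m : ℂ → ℕ} {g : ℂ → ℂ} {z : ℂ}
    (hZ : ∀ a ∈ Z, z ≠ a) (hg : DifferentiableAt ℂ g z) (hgz : g z ≠ 0) :
    logDeriv (fun w => (∏ a ∈ Z, (w - a) ^ m a) * g w) z =
      ∑ a ∈ Z, (m a : ℂ) * (1 / (z - a)) + logDeriv g z := by
  have h1 : ∀ a ∈ Z, (z - a) ^ m a ≠ 0 := fun a ha => pow_ne_zero _ (sub_ne_zero.2 (hZ a ha))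
  rw [logDeriv_mul z (Finset.prod_ne_zero_iff.2 h1) hgz
    (DifferentiableAt.fun_finsetProd fun a _ => by fun_prop) hg]
  congr 1
  rw [logDeriv_prod h1 (fun a _ => by fun_prop)]
  refine Finset.sum_congr rfl fun a ha => ?_
  rw [logDeriv_fun_pow (by fun_prop)]
  congr 1
  simp [logDeriv_apply]

/-! ### The argument principle on rectangles. -/

/-- The integral of `f` over the boundary of the rectangle with opposite corners `z`, `w`. -/
noncomputable def rectIntegral (f : ℂ → ℂ) (z w : ℂ) : ℂ :=
  (∫ x : ℝ in z.re..w.re, f (x + z.im * Complex.I)) -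
    (∫ x : ℝ in z.re..w.re, f (x + w.im * Complex.I)) +
    Complex.I * (∫ y : ℝ in z.im..w.im, f (w.re + y * Complex.I)) -
    Complex.I * (∫ y : ℝ in z.im..w.im, f (z.re + y * Complex.I))

/-- The boundary of the rectangle with lower left corner `z` and upper right corner `w`. -/
def rectBoundary (z w : ℂ) : Set ℂ :=
  {s | s.re ∈ Icc z.re w.re ∧ s.im ∈ Icc z.im w.im ∧
    (s.re = z.re ∨ s.re = w.re ∨ s.im = z.im ∨ s.im = w.im)}

section rect
variable {z w : ℂ} {f g : ℂ → ℂ}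

theorem rectBoundary_bottom (h2 : z.im ≤ w.im) {x : ℝ} (hx : x ∈ Icc z.re w.re) :
    (x + z.im * Complex.I : ℂ) ∈ rectBoundary z w := by
  simp [rectBoundary, hx.1, hx.2, h2]

theorem rectBoundary_top (h2 : z.im ≤ w.im) {x : ℝ} (hx : x ∈ Icc z.re w.re) :
    (x + w.im * Complex.I : ℂ) ∈ rectBoundary z w := by
  simp [rectBoundary, hx.1, hx.2, h2]

theorem rectBoundary_right (h1 : z.re ≤ w.re) {y : ℝ} (hy : y ∈ Icc z.im w.im) :
    (w.re + y * Complex.I : ℂ) ∈ rectBoundary z w := by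
  simp [rectBoundary, hy.1, hy.2, h1]

theorem rectBoundary_left (h1 : z.re ≤ w.re) {y : ℝ} (hy : y ∈ Icc z.im w.im) :
    (z.re + y * Complex.I : ℂ) ∈ rectBoundary z w := by
  simp [rectBoundary, hy.1, hy.2, h1]

theorem intervalIntegrable_of_mapsTo_rectBoundary {a b : ℝ} (hab : a ≤ b) {γ : ℝ → ℂ}
    (hγ : Continuous γ) (hm : MapsTo γ (Icc a b) (rectBoundary z w))
    (hf : ContinuousOn f (rectBoundary z w)) :
    IntervalIntegrable (fun x => f (γ x)) MeasureTheory.volume a b := by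
  apply ContinuousOn.intervalIntegrable
  rw [uIcc_of_le hab]
  exact hf.comp hγ.continuousOn hm

theorem rectIntegral_add (h1 : z.re ≤ w.re) (h2 : z.im ≤ w.im)
    (hf : ContinuousOn f (rectBoundary z w)) (hg : ContinuousOn g (rectBoundary z w)) :
    rectIntegral (fun s => f s + g s) z w = rectIntegral f z w + rectIntegral g z w := by
  have e1 := intervalIntegral.integral_add
    (intervalIntegrable_of_mapsTo_rectBoundary h1 (by fun_prop) (fun x hx => rectBoundary_bottom h2 hx) hf)
    (intervalIntegrable_of_mapsTo_rectBoundary h1 (by fun_prop) (fun x hx => rectBoundary_bottom h2 hx) hg)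
  have e2 := intervalIntegral.integral_add
    (intervalIntegrable_of_mapsTo_rectBoundary h1 (by fun_prop) (fun x hx => rectBoundary_top h2 hx) hf)
    (intervalIntegrable_of_mapsTo_rectBoundary h1 (by fun_prop) (fun x hx => rectBoundary_top h2 hx) hg)
  have e3 := intervalIntegral.integral_add
    (intervalIntegrable_of_mapsTo_rectBoundary h2 (by fun_prop) (fun x hx => rectBoundary_right h1 hx) hf)
    (intervalIntegrable_of_mapsTo_rectBoundary h2 (by fun_prop) (fun x hx => rectBoundary_right h1 hx) hg)
  have e4 := intervalIntegral.integral_add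
    (intervalIntegrable_of_mapsTo_rectBoundary h2 (by fun_prop) (fun x hx => rectBoundary_left h1 hx) hf)
    (intervalIntegrable_of_mapsTo_rectBoundary h2 (by fun_prop) (fun x hx => rectBoundary_left h1 hx) hg)
  simp only [rectIntegral, e1, e2, e3, e4]
  ring

theorem rectIntegral_const_mul (c : ℂ) :
    rectIntegral (fun s => c * f s) z w = c * rectIntegral f z w := by
  simp only [rectIntegral, intervalIntegral.integral_const_mul]
  ring

theorem rectIntegral_congr (h1 : z.re ≤ w.re) (h2 : z.im ≤ w.im)
    (h : ∀ s ∈ rectBoundary z w, f s = g s) : rectIntegral f z w = rectIntegral g z w := by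
  have e1 : (∫ x : ℝ in z.re..w.re, f (x + z.im * Complex.I)) =
      ∫ x : ℝ in z.re..w.re, g (x + z.im * Complex.I) := by
    refine intervalIntegral.integral_congr fun x hx => ?_
    rw [uIcc_of_le h1] at hx
    exact h _ (rectBoundary_bottom h2 hx)
  have e2 : (∫ x : ℝ in z.re..w.re, f (x + w.im * Complex.I)) =
      ∫ x : ℝ in z.re..w.re, g (x + w.im * Complex.I) := by
    refine intervalIntegral.integral_congr fun x hx => ?_
    rw [uIcc_of_le h1] at hx
    exact h _ (rectBoundary_top h2 hx)
  have e3 : (∫ y : ℝ in z.im..w.im, f (w.re + y * Complex.I)) =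
      ∫ y : ℝ in z.im..w.im, g (w.re + y * Complex.I) := by
    refine intervalIntegral.integral_congr fun x hx => ?_
    rw [uIcc_of_le h2] at hx
    exact h _ (rectBoundary_right h1 hx)
  have e4 : (∫ y : ℝ in z.im..w.im, f (z.re + y * Complex.I)) =
      ∫ y : ℝ in z.im..w.im, g (z.re + y * Complex.I) := by
    refine intervalIntegral.integral_congr fun x hx => ?_
    rw [uIcc_of_le h2] at hx
    exact h _ (rectBoundary_left h1 hx)
  simp only [rectIntegral, e1, e2, e3, e4]

theorem rectIntegral_sub (h1 : z.re ≤ w.re) (h2 : z.im ≤ w.im)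
    (hf : ContinuousOn f (rectBoundary z w)) (hg : ContinuousOn g (rectBoundary z w)) :
    rectIntegral (fun s => f s - g s) z w = rectIntegral f z w - rectIntegral g z w := by
  have h := rectIntegral_add (g := fun s => (-1) * g s) h1 h2 hf (continuousOn_const.mul hg)
  rw [rectIntegral_const_mul] at h
  calc _ = _ := rectIntegral_congr h1 h2 fun s _ => by ring
    _ = _ := h
    _ = _ := by ring

theorem rectIntegral_sum {ι : Type*} (h1 : z.re ≤ w.re) (h2 : z.im ≤ w.im) (S : Finset ι)
    (F : ι → ℂ → ℂ) (hF : ∀ i ∈ S, ContinuousOn (F i) (rectBoundary z w)) :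
    rectIntegral (fun s => ∑ i ∈ S, F i s) z w = ∑ i ∈ S, rectIntegral (F i) z w := by
  classical
  induction S using Finset.induction_on with
  | empty => simp [rectIntegral]
  | insert i S hi ih =>
    simp only [Finset.sum_insert hi]
    rw [rectIntegral_add h1 h2 (hF i (Finset.mem_insert_self i S))
      (continuousOn_finsetSum _ fun j hj => hF j (Finset.mem_insert_of_mem hj)),
      ih fun j hj => hF j (Finset.mem_insert_of_mem hj)]

theorem rectIntegral_eq_zero_of_differentiableOn (h1 : z.re ≤ w.re) (h2 : z.im ≤ w.im)
    (hf : DifferentiableOn ℂ f (Icc z.re w.re ×ℂ Icc z.im w.im)) : rectIntegral f z w = 0 := by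
  rw [← uIcc_of_le h1, ← uIcc_of_le h2] at hf
  exact Complex.integral_boundary_rect_eq_zero_of_differentiableOn f z w hf

theorem rectIntegral_eq_zero_of_hasDerivAt {G : ℂ → ℂ} (h1 : z.re ≤ w.re) (h2 : z.im ≤ w.im)
    (hf : ContinuousOn f (rectBoundary z w)) (hG : ∀ s ∈ rectBoundary z w, HasDerivAt G (f s) s) :
    rectIntegral f z w = 0 := by
  have hor : ∀ c : ℝ, (∀ x ∈ Icc z.re w.re, (x + c * Complex.I : ℂ) ∈ rectBoundary z w) →
      (∫ x : ℝ in z.re..w.re, f (x + c * Complex.I)) =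
        G (w.re + c * Complex.I) - G (z.re + c * Complex.I) := by
    intro c hc
    refine intervalIntegral.integral_eq_sub_of_hasDerivAt
      (f := fun x : ℝ => G (x + c * Complex.I)) (fun x hx => ?_)
      (intervalIntegrable_of_mapsTo_rectBoundary h1 (by fun_prop) hc hf)
    rw [uIcc_of_le h1] at hx
    have ha : HasDerivAt (fun x : ℝ => (x + c * Complex.I : ℂ)) 1 x :=
      (HasDerivAt.ofReal_comp (hasDerivAt_id x)).add_const _
    exact ((hG _ (hc x hx)).comp x ha).congr_deriv (mul_one _)
  have ver : ∀ c : ℝ, (∀ y ∈ Icc z.im w.im, (c + y * Complex.I : ℂ) ∈ rectBoundary z w) →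
      Complex.I * (∫ y : ℝ in z.im..w.im, f (c + y * Complex.I)) =
        G (c + w.im * Complex.I) - G (c + z.im * Complex.I) := by
    intro c hc
    rw [← intervalIntegral.integral_const_mul]
    refine intervalIntegral.integral_eq_sub_of_hasDerivAt
      (f := fun y : ℝ => G (c + y * Complex.I)) (fun y hy => ?_)
      ((intervalIntegrable_of_mapsTo_rectBoundary h2 (by fun_prop) hc hf).const_mul _)
    rw [uIcc_of_le h2] at hy
    have ha : HasDerivAt (fun y : ℝ => (c + y * Complex.I : ℂ)) Complex.I y := by
      simpa using ((HasDerivAt.ofReal_comp (hasDerivAt_id y)).mul_const Complex.I).const_add (c : ℂ)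
    exact ((hG _ (hc y hy)).comp y ha).congr_deriv (mul_comm _ _)
  rw [rectIntegral, hor _ fun x hx => rectBoundary_bottom h2 hx,
    hor _ fun x hx => rectBoundary_top h2 hx, ver _ fun y hy => rectBoundary_right h1 hy,
    ver _ fun y hy => rectBoundary_left h1 hy]
  ring

theorem rectIntegral_logDeriv_eq_zero (h1 : z.re ≤ w.re) (h2 : z.im ≤ w.im)
    (hf : ∀ s ∈ rectBoundary z w, AnalyticAt ℂ f s)
    (hs : ∀ s ∈ rectBoundary z w, f s ∈ Complex.slitPlane) :
    rectIntegral (logDeriv f) z w = 0 := by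
  refine rectIntegral_eq_zero_of_hasDerivAt (G := fun s => Complex.log (f s)) h1 h2 ?_ ?_
  · intro s hsb
    exact ((hf s hsb).deriv.div (hf s hsb) (Complex.slitPlane_ne_zero (hs s hsb))).continuousAt.continuousWithinAt
  · intro s hsb
    exact (hf s hsb).differentiableAt.hasDerivAt.clog (hs s hsb)

theorem continuousOn_one_div_sub_rectBoundary {a : ℂ} (ha : a ∉ rectBoundary z w) :
    ContinuousOn (fun s => 1 / (s - a)) (rectBoundary z w) := by
  refine continuousOn_const.div (by fun_prop) fun s hs => sub_ne_zero.2 ?_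
  rintro rfl; exact ha hs

theorem notMem_rectBoundary_of_mem_Ioo {a : ℂ} (ha : a ∈ Ioo z.re w.re ×ℂ Ioo z.im w.im) :
    a ∉ rectBoundary z w := by
  rintro ⟨-, -, h⟩
  obtain ⟨⟨p1, p2⟩, ⟨p3, p4⟩⟩ := ha
  rcases h with h | h | h | h <;> linarith

/-- A quotient equal to −t with t ≥ 0 would make s = (a + t b)/(1 + t), a point of the segment.
Hence log ((s − a)/(s − b)) is single-valued off the segment. -/
theorem sub_div_sub_mem_slitPlane {a b s : ℂ} (hs : s ∉ segment ℝ a b) :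
    (s - a) / (s - b) ∈ Complex.slitPlane := by
  by_contra hcon
  apply hs
  rw [Complex.mem_slitPlane_iff_not_le_zero, not_not] at hcon
  by_cases hb : s = b
  · subst hb; exact right_mem_segment ℝ a s
  have hb' : s - b ≠ 0 := sub_ne_zero.2 hb
  obtain ⟨t, ht, hts⟩ : ∃ t : ℝ, 0 ≤ t ∧ (s - a) / (s - b) = -(t : ℂ) := by
    refine ⟨-((s - a) / (s - b)).re, by have := (Complex.le_def.1 hcon).1; simpa using this, ?_⟩
    apply Complex.ext
    · simp
    · have := (Complex.le_def.1 hcon).2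
      simpa using this
  rw [div_eq_iff hb'] at hts
  refine ⟨1 / (1 + t), t / (1 + t), by positivity, by positivity, by field_simp, ?_⟩
  have h1 : (1 + (t : ℂ)) ≠ 0 := by
    have : (0 : ℝ) < 1 + t := by positivity
    exact_mod_cast this.ne'
  simp only [Complex.real_smul]
  push_cast
  field_simp
  linear_combination (-1 : ℂ) * hts

/-- The open rectangle is convex, so the segment from a to b misses the boundary and log ((s − a)/(s
− b)) is a primitive there of the difference of the integrands. -/
theorem rectIntegral_one_div_sub_eq {a b : ℂ} (h1 : z.re ≤ w.re) (h2 : z.im ≤ w.im)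
    (ha : a ∈ Ioo z.re w.re ×ℂ Ioo z.im w.im) (hb : b ∈ Ioo z.re w.re ×ℂ Ioo z.im w.im) :
    rectIntegral (fun s => 1 / (s - a)) z w = rectIntegral (fun s => 1 / (s - b)) z w := by
  have hconv : Convex ℝ (Ioo z.re w.re ×ℂ Ioo z.im w.im) :=
    ((convex_Ioo z.re w.re).linear_preimage Complex.reLm).inter
      ((convex_Ioo z.im w.im).linear_preimage Complex.imLm)
  have hseg : ∀ s ∈ rectBoundary z w, s ∉ segment ℝ a b := fun s hs hs' =>
    notMem_rectBoundary_of_mem_Ioo (hconv.segment_subset ha hb hs') hs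
  have hane : ∀ s ∈ rectBoundary z w, s - a ≠ 0 := fun s hs => by
    refine sub_ne_zero.2 ?_; rintro rfl; exact notMem_rectBoundary_of_mem_Ioo ha hs
  have hbne : ∀ s ∈ rectBoundary z w, s - b ≠ 0 := fun s hs => by
    refine sub_ne_zero.2 ?_; rintro rfl; exact notMem_rectBoundary_of_mem_Ioo hb hs
  have h0 := rectIntegral_logDeriv_eq_zero (f := fun s => (s - a) / (s - b)) h1 h2
    (fun s hs => (by fun_prop : AnalyticAt ℂ (fun s => s - a) s).fun_div (by fun_prop) (hbne s hs))
    (fun s hs => sub_div_sub_mem_slitPlane (hseg s hs))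
  rw [rectIntegral_congr (g := fun s => 1 / (s - a) - 1 / (s - b)) h1 h2,
    rectIntegral_sub h1 h2
      (continuousOn_one_div_sub_rectBoundary (notMem_rectBoundary_of_mem_Ioo ha))
      (continuousOn_one_div_sub_rectBoundary (notMem_rectBoundary_of_mem_Ioo hb))] at h0
  · linear_combination h0
  · intro s hs
    rw [logDeriv_div s (hane s hs) (hbne s hs) (by fun_prop) (by fun_prop)]
    simp [logDeriv_apply]

/-- Each of the four sides contributes a positive imaginary part. The value 2πi is never needed: the
integral is a common factor in the comparison of two zero counts, so it only has to be cancellable.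
-/
theorem rectIntegral_one_div_sub_ne_zero {a : ℂ}
    (ha : a ∈ Ioo z.re w.re ×ℂ Ioo z.im w.im) :
    rectIntegral (fun s => 1 / (s - a)) z w ≠ 0 := by
  obtain ⟨⟨p1, p2⟩, ⟨p3, p4⟩⟩ := id ha
  have h1 : z.re < w.re := p1.trans p2
  have h2 : z.im < w.im := p3.trans p4
  have hc := continuousOn_one_div_sub_rectBoundary (notMem_rectBoundary_of_mem_Ioo ha)
  have hpos : ∀ {c d : ℝ} {γ : ℝ → ℂ} (L : ℂ →L[ℝ] ℝ), c < d → Continuous γ →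
      MapsTo γ (Icc c d) (rectBoundary z w) → (∀ x ∈ Icc c d, 0 < L (1 / (γ x - a))) →
      0 < L (∫ x in c..d, 1 / (γ x - a)) := by
    intro c d γ L hcd hγ hm hp
    have hi := intervalIntegrable_of_mapsTo_rectBoundary hcd.le hγ hm hc
    rw [← L.intervalIntegral_comp_comm hi]
    refine intervalIntegral.intervalIntegral_pos_of_pos_on ?_ (fun x hx => hp x (Ioo_subset_Icc_self hx)) hcd
    apply ContinuousOn.intervalIntegrable
    rw [uIcc_of_le hcd.le]
    exact L.continuous.comp_continuousOn (hc.comp hγ.continuousOn hm)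
  have hne : ∀ {s : ℂ}, s ∈ rectBoundary z w → 0 < Complex.normSq (s - a) := fun hs => by
    refine Complex.normSq_pos.2 (sub_ne_zero.2 ?_)
    rintro rfl; exact notMem_rectBoundary_of_mem_Ioo ha hs
  have b1 : 0 < (∫ x : ℝ in z.re..w.re, 1 / ((x + z.im * Complex.I : ℂ) - a)).im :=
    hpos (γ := fun x : ℝ => (x + z.im * Complex.I : ℂ)) Complex.imCLM h1 (by fun_prop) (fun x hx => rectBoundary_bottom h2.le hx) fun x hx => by
      have := hne (rectBoundary_bottom h2.le hx)
      simp only [Complex.imCLM_apply, one_div, Complex.inv_im]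
      refine div_pos ?_ this
      simpa using p3
  have b2 : 0 < -(∫ x : ℝ in z.re..w.re, 1 / ((x + w.im * Complex.I : ℂ) - a)).im :=
    hpos (γ := fun x : ℝ => (x + w.im * Complex.I : ℂ)) (-Complex.imCLM) h1 (by fun_prop) (fun x hx => rectBoundary_top h2.le hx) fun x hx => by
      have := hne (rectBoundary_top h2.le hx)
      simp only [neg_apply, Complex.imCLM_apply, one_div, Complex.inv_im]
      rw [← neg_div]
      refine div_pos ?_ this
      simpa using p4
  have b3 : 0 < (∫ y : ℝ in z.im..w.im, 1 / ((w.re + y * Complex.I : ℂ) - a)).re :=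
    hpos (γ := fun y : ℝ => (w.re + y * Complex.I : ℂ)) Complex.reCLM h2 (by fun_prop) (fun x hx => rectBoundary_right h1.le hx) fun x hx => by
      have := hne (rectBoundary_right h1.le hx)
      simp only [Complex.reCLM_apply, one_div, Complex.inv_re]
      refine div_pos ?_ this
      simpa using p2
  have b4 : 0 < -(∫ y : ℝ in z.im..w.im, 1 / ((z.re + y * Complex.I : ℂ) - a)).re :=
    hpos (γ := fun y : ℝ => (z.re + y * Complex.I : ℂ)) (-Complex.reCLM) h2 (by fun_prop) (fun x hx => rectBoundary_left h1.le hx) fun x hx => by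
      have := hne (rectBoundary_left h1.le hx)
      simp only [neg_apply, Complex.reCLM_apply, one_div, Complex.inv_re]
      rw [← neg_div]
      refine div_pos ?_ this
      simpa using p1
  intro h0
  have := congrArg Complex.im h0
  simp only [rectIntegral, Complex.sub_im, Complex.add_im, Complex.mul_im, Complex.I_re,
    Complex.I_im, zero_mul, one_mul, zero_add, Complex.zero_im] at this
  linarith

/-- The argument principle for a rectangle. -/
theorem rectIntegral_logDeriv_eq {U : Set ℂ} (h1 : z.re ≤ w.re) (h2 : z.im ≤ w.im)
    (hRU : Icc z.re w.re ×ℂ Icc z.im w.im ⊆ U) (hf : AnalyticOnNhd ℂ f U)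
    (hfin : ∀ s ∈ U, analyticOrderAt f s ≠ ⊤) (hb : ∀ s ∈ rectBoundary z w, f s ≠ 0)
    {a : ℂ} (ha : a ∈ Ioo z.re w.re ×ℂ Ioo z.im w.im) :
    rectIntegral (logDeriv f) z w =
      (zeroCount f (Icc z.re w.re ×ℂ Icc z.im w.im) : ℂ) * rectIntegral (fun s => 1 / (s - a)) z w := by
  have hcpt : IsCompact (Icc z.re w.re ×ℂ Icc z.im w.im) := isCompact_Icc.reProdIm isCompact_Icc
  have hZ := finite_zeros_of_isCompact hf hfin hcpt hRU
  have hbsub : rectBoundary z w ⊆ Icc z.re w.re ×ℂ Icc z.im w.im := fun s hs => ⟨hs.1, hs.2.1⟩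
  obtain ⟨g, hg, hgZ, hfg⟩ := exists_eq_prod_mul hf hfin hZ.toFinset
    (fun s hs => hRU (by simpa using ((hZ.mem_toFinset).1 hs).1))
  have hgne : ∀ s ∈ Icc z.re w.re ×ℂ Icc z.im w.im, g s ≠ 0 := by
    intro s hs h0
    refine hgZ s (hZ.mem_toFinset.2 ⟨hs, ?_⟩) h0
    rw [hfg s, h0, mul_zero]
  have hint : ∀ b ∈ hZ.toFinset, b ∈ Ioo z.re w.re ×ℂ Ioo z.im w.im := by
    intro b hbZ
    obtain ⟨⟨⟨q1, q2⟩, ⟨q3, q4⟩⟩, q5⟩ := hZ.mem_toFinset.1 hbZ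
    have hnb : b ∉ rectBoundary z w := fun h => hb b h q5
    simp only [rectBoundary, mem_ofPred_eq, not_and, not_or] at hnb
    obtain ⟨r1, r2, r3, r4⟩ := hnb ⟨q1, q2⟩ ⟨q3, q4⟩
    exact ⟨⟨lt_of_le_of_ne q1 (Ne.symm r1), lt_of_le_of_ne q2 r2⟩,
      ⟨lt_of_le_of_ne q3 (Ne.symm r3), lt_of_le_of_ne q4 r4⟩⟩
  have hcont : ∀ b ∈ hZ.toFinset, ContinuousOn (fun s => (analyticOrderNatAt f b : ℂ) * (1 / (s - b)))
      (rectBoundary z w) := fun b hbZ => continuousOn_const.mul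
    (continuousOn_one_div_sub_rectBoundary (notMem_rectBoundary_of_mem_Ioo (hint b hbZ)))
  have hgd : DifferentiableOn ℂ (logDeriv g) (Icc z.re w.re ×ℂ Icc z.im w.im) := fun s hs =>
    ((hg s (hRU hs)).deriv.div (hg s (hRU hs)) (hgne s hs)).differentiableAt.differentiableWithinAt
  rw [rectIntegral_congr (g := fun s => (∑ b ∈ hZ.toFinset, (analyticOrderNatAt f b : ℂ) * (1 / (s - b))) +
      logDeriv g s) h1 h2, rectIntegral_add h1 h2 (continuousOn_finsetSum _ hcont)
      (hgd.continuousOn.mono hbsub), rectIntegral_sum h1 h2 _ _ hcont,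
      rectIntegral_eq_zero_of_differentiableOn h1 h2 hgd, add_zero]
  · have hz : zeroCount f (Icc z.re w.re ×ℂ Icc z.im w.im) = ∑ b ∈ hZ.toFinset, analyticOrderNatAt f b := by
      rw [zeroCount]
      exact finsum_mem_eq_finite_toFinset_sum _ hZ
    rw [hz]
    push_cast
    rw [Finset.sum_mul]
    refine Finset.sum_congr rfl fun b hbZ => ?_
    rw [rectIntegral_const_mul, rectIntegral_one_div_sub_eq h1 h2 (hint b hbZ) ha]
  · intro s hs
    have e : f = fun s => (∏ b ∈ hZ.toFinset, (s - b) ^ analyticOrderNatAt f b) * g s := funext hfg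
    conv_lhs => rw [e]
    refine logDeriv_prod_sub_pow (fun b hbZ => ?_) (hg s (hRU (hbsub hs))).differentiableAt (hgne s (hbsub hs))
    rintro rfl
    exact notMem_rectBoundary_of_mem_Ioo (hint s hbZ) hs

/-- A Rouché-type comparison: if `Re (f / g) < 0` on the boundary of a rectangle, then `f` and `g`
have the same number of zeros inside. -/
theorem zeroCount_eq_of_re_div_neg {U : Set ℂ} (h1 : z.re < w.re) (h2 : z.im < w.im)
    (hRU : Icc z.re w.re ×ℂ Icc z.im w.im ⊆ U) (hf : AnalyticOnNhd ℂ f U) (hg : AnalyticOnNhd ℂ g U)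
    (hfin : ∀ s ∈ U, analyticOrderAt f s ≠ ⊤) (hgin : ∀ s ∈ U, analyticOrderAt g s ≠ ⊤)
    (hb : ∀ s ∈ rectBoundary z w, (f s / g s).re < 0) :
    zeroCount f (Icc z.re w.re ×ℂ Icc z.im w.im) = zeroCount g (Icc z.re w.re ×ℂ Icc z.im w.im) := by
  have hbU : ∀ s ∈ rectBoundary z w, s ∈ U := fun s hs => hRU ⟨hs.1, hs.2.1⟩
  -- Since x / 0 = 0, strict negativity of the real part excludes zeros of `f` and of `g` alike.
  have hfb : ∀ s ∈ rectBoundary z w, f s ≠ 0 := fun s hs h0 => by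
    have := hb s hs; simp [h0] at this
  have hgb : ∀ s ∈ rectBoundary z w, g s ≠ 0 := fun s hs h0 => by
    have := hb s hs; simp [h0] at this
  obtain ⟨p, hp1, hp2⟩ := exists_between h1
  obtain ⟨q, hq1, hq2⟩ := exists_between h2
  have ha : (⟨p, q⟩ : ℂ) ∈ Ioo z.re w.re ×ℂ Ioo z.im w.im := ⟨⟨hp1, hp2⟩, ⟨hq1, hq2⟩⟩
  have e1 := rectIntegral_logDeriv_eq h1.le h2.le hRU hf hfin hfb ha
  have e2 := rectIntegral_logDeriv_eq h1.le h2.le hRU hg hgin hgb ha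
  -- The sign moves the values into the right half-plane, where the principal logarithm is analytic.
  have e3 := rectIntegral_logDeriv_eq_zero (f := fun s => -(f s / g s)) h1.le h2.le
    (fun s hs => ((hf s (hbU s hs)).fun_div (hg s (hbU s hs)) (hgb s hs)).neg)
    (fun s hs => Or.inl (by simpa using hb s hs))
  have hcf : ContinuousOn (logDeriv f) (rectBoundary z w) := fun s hs =>
    ((hf s (hbU s hs)).deriv.div (hf s (hbU s hs)) (hfb s hs)).continuousAt.continuousWithinAt
  have hcg : ContinuousOn (logDeriv g) (rectBoundary z w) := fun s hs =>
    ((hg s (hbU s hs)).deriv.div (hg s (hbU s hs)) (hgb s hs)).continuousAt.continuousWithinAt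
  rw [rectIntegral_congr (g := fun s => logDeriv f s - logDeriv g s) h1.le h2.le,
    rectIntegral_sub h1.le h2.le hcf hcg, e1, e2] at e3
  · have e4 : ((zeroCount f (Icc z.re w.re ×ℂ Icc z.im w.im) : ℂ) -
        zeroCount g (Icc z.re w.re ×ℂ Icc z.im w.im)) *
        rectIntegral (fun s => 1 / (s - ⟨p, q⟩)) z w = 0 := by linear_combination e3
    have e5 := (mul_eq_zero.1 e4).resolve_right (rectIntegral_one_div_sub_ne_zero ha)
    exact_mod_cast sub_eq_zero.1 e5
  · intro s hs
    have : (fun s => -(f s / g s)) = fun s => (-1 : ℂ) * (f s / g s) := by funext s; ring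
    rw [this, logDeriv_const_mul s _ (by norm_num), logDeriv_div s (hfb s hs) (hgb s hs)
      (hf s (hbU s hs)).differentiableAt (hg s (hbU s hs)).differentiableAt]
end rect

/-! ### Upper and lower bounds for ζ. -/

/-- The difference `n ^ (-s) - ∫ x in n..n+1, x ^ (-s)`. -/
noncomputable def zetaTerm (n : ℕ) (s : ℂ) : ℂ :=
  (n : ℂ) ^ (-s) - (((n + 1 : ℕ) : ℂ) ^ (1 - s) - (n : ℂ) ^ (1 - s)) / (1 - s)

theorem hasDerivAt_ofReal_cpow {x : ℝ} (hx : 0 < x) (r : ℂ) :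
    HasDerivAt (fun y : ℝ => (y : ℂ) ^ r) (r * (x : ℂ) ^ (r - 1)) x := by
  have h := ((hasDerivAt_id (x : ℂ)).cpow_const (c := r) (Or.inl (by simpa using hx))).comp_ofReal
  simpa using h

theorem norm_zetaTerm_le {n : ℕ} (hn : 1 ≤ n) {s : ℂ} (hs : 0 < s.re) (hs1 : s ≠ 1) :
    ‖zetaTerm n s‖ ≤ ‖s‖ * (n : ℝ) ^ (-s.re - 1) := by
  have hn0 : (0 : ℝ) < n := by exact_mod_cast hn
  have hpos : ∀ x ∈ Icc (n : ℝ) (n + 1), 0 < x := fun x hx => hn0.trans_le hx.1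
  have hB : ∀ x ∈ Icc (n : ℝ) (n + 1), ‖(n : ℂ) ^ (-s) - (x : ℂ) ^ (-s)‖ ≤
      ‖s‖ * (n : ℝ) ^ (-s.re - 1) := by
    intro x hx
    have h := (convex_Icc (n : ℝ) (n + 1)).norm_image_sub_le_of_norm_hasDerivWithin_le
      (f := fun y : ℝ => (y : ℂ) ^ (-s)) (f' := fun y : ℝ => (-s) * (y : ℂ) ^ (-s - 1))
      (C := ‖s‖ * (n : ℝ) ^ (-s.re - 1))
      (fun y hy => (hasDerivAt_ofReal_cpow (hpos y hy) _).hasDerivWithinAt)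
      (fun y hy => by
        rw [norm_mul, norm_neg, Complex.norm_cpow_eq_rpow_re_of_pos (hpos y hy)]
        simp only [Complex.sub_re, Complex.neg_re, Complex.one_re]
        gcongr ?_ * ?_
        exact Real.rpow_le_rpow_of_nonpos hn0 hy.1 (by linarith))
      hx (left_mem_Icc.2 (by linarith))
    simp only [Complex.ofReal_natCast] at h
    refine h.trans (mul_le_of_le_one_right (by positivity) ?_)
    rw [Real.norm_eq_abs, abs_le]
    constructor <;> linarith [hx.1, hx.2]
  have hs1' : 1 - s ≠ 0 := sub_ne_zero.2 hs1.symm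
  -- A second use of the mean value inequality: `zetaTerm n s` is the increment over [n, n + 1] of a
  -- function whose derivative was bounded in `hB`.
  have h := (convex_Icc (n : ℝ) (n + 1)).norm_image_sub_le_of_norm_hasDerivWithin_le
      (f := fun y : ℝ => (y : ℂ) * (n : ℂ) ^ (-s) - (y : ℂ) ^ (1 - s) / (1 - s))
      (f' := fun y : ℝ => (n : ℂ) ^ (-s) - (y : ℂ) ^ (-s))
      (C := ‖s‖ * (n : ℝ) ^ (-s.re - 1))
      (fun y hy => by
        have h1 := (HasDerivAt.ofReal_comp (hasDerivAt_id y)).mul_const ((n : ℂ) ^ (-s))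
        have h2 := (hasDerivAt_ofReal_cpow (hpos y hy) (1 - s)).div_const (1 - s)
        refine ((h1.sub h2).congr_deriv ?_).hasDerivWithinAt
        rw [mul_div_cancel_left₀ _ hs1']
        simp)
      hB (left_mem_Icc.2 (by linarith)) (right_mem_Icc.2 (by linarith))
  have e : zetaTerm n s = (((n : ℝ) + 1 : ℝ) : ℂ) * (n : ℂ) ^ (-s) -
      (((n : ℝ) + 1 : ℝ) : ℂ) ^ (1 - s) / (1 - s) -
      (((n : ℝ) : ℂ) * (n : ℂ) ^ (-s) - ((n : ℝ) : ℂ) ^ (1 - s) / (1 - s)) := by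
    rw [zetaTerm]; push_cast; ring
  rw [e]
  simpa using h

theorem summable_nat_add_one_rpow {p : ℝ} (hp : 1 < p) :
    Summable fun k : ℕ => ((k + 1 : ℕ) : ℝ) ^ (-p) := by
  exact (summable_nat_add_iff (f := fun k : ℕ => (k : ℝ) ^ (-p)) 1).2
    (Real.summable_nat_rpow.2 (by linarith))

theorem summable_zetaTerm {s : ℂ} (hs : 0 < s.re) (hs1 : s ≠ 1) :
    Summable fun k : ℕ => zetaTerm (k + 1) s := by
  refine Summable.of_norm_bounded
    ((summable_nat_add_one_rpow (p := s.re + 1) (by linarith)).mul_left ‖s‖) fun k => ?_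
  rw [show -(s.re + 1) = -s.re - 1 by ring]
  exact norm_zetaTerm_le (by lia) hs hs1

theorem sum_range_zetaTerm (s : ℂ) (N : ℕ) :
    ∑ k ∈ Finset.range N, zetaTerm (k + 1) s =
      ∑ k ∈ Finset.range N, ((k + 1 : ℕ) : ℂ) ^ (-s) - (((N + 1 : ℕ) : ℂ) ^ (1 - s) - 1) / (1 - s) := by
  induction N with
  | zero => simp
  | succ N ih =>
    rw [Finset.sum_range_succ, Finset.sum_range_succ, ih, zetaTerm]
    ring

theorem riemannZeta_eq_tsum_zetaTerm_of_one_lt {s : ℂ} (hs : 1 < s.re) :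
    riemannZeta s = 1 / (s - 1) + ∑' k : ℕ, zetaTerm (k + 1) s := by
  have hs1 : s ≠ 1 := by rintro rfl; simp at hs
  have h1 := (summable_zetaTerm (by linarith) hs1).hasSum.tendsto_sum_nat
  have h2 : HasSum (fun k : ℕ => ((k + 1 : ℕ) : ℂ) ^ (-s)) (riemannZeta s) := by
    have hsum : Summable fun k : ℕ => ((k + 1 : ℕ) : ℂ) ^ (-s) := by
      refine Summable.of_norm_bounded (summable_nat_add_one_rpow hs) fun k => ?_
      rw [Complex.norm_natCast_cpow_of_pos (by lia)]; simp
    rw [zeta_eq_tsum_one_div_nat_add_one_cpow hs]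
    convert hsum.hasSum using 1
    refine tsum_congr fun k => ?_
    rw [Complex.cpow_neg]; simp
  have h3 : Tendsto (fun N : ℕ => ((N + 1 : ℕ) : ℂ) ^ (1 - s)) atTop (𝓝 0) := by
    rw [tendsto_zero_iff_norm_tendsto_zero]
    have h4 := (tendsto_rpow_neg_atTop (y := s.re - 1) (by linarith)).comp
      ((tendsto_natCast_atTop_atTop (R := ℝ)).comp (tendsto_add_atTop_nat 1))
    refine h4.congr fun N => ?_
    rw [Complex.norm_natCast_cpow_of_pos (by lia)]
    simp
  have h5 := h2.tendsto_sum_nat.sub ((h3.sub_const 1).div_const (1 - s))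
  simp_rw [← sum_range_zetaTerm] at h5
  rw [tendsto_nhds_unique h1 h5]
  have a1 : s - 1 ≠ 0 := sub_ne_zero.2 hs1
  have a2 : 1 - s ≠ 0 := sub_ne_zero.2 hs1.symm
  rw [← neg_sub s 1]
  field_simp
  ring

theorem differentiableAt_zetaTerm {n : ℕ} (hn : 1 ≤ n) {s : ℂ} (hs1 : s ≠ 1) :
    DifferentiableAt ℂ (zetaTerm n) s := by
  have a2 : 1 - s ≠ 0 := sub_ne_zero.2 hs1.symm
  have h1 : (n : ℂ) ≠ 0 := by exact_mod_cast (by lia : n ≠ 0)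
  have h2 : ((n + 1 : ℕ) : ℂ) ≠ 0 := by exact_mod_cast (by lia : n + 1 ≠ 0)
  unfold zetaTerm
  refine DifferentiableAt.sub ?_ (DifferentiableAt.div (DifferentiableAt.sub ?_ ?_) (by fun_prop) a2)
  · exact DifferentiableAt.const_cpow (by fun_prop) (Or.inl h1)
  · exact DifferentiableAt.const_cpow (by fun_prop) (Or.inl h2)
  · exact DifferentiableAt.const_cpow (by fun_prop) (Or.inl h1)

theorem differentiableAt_tsum_zetaTerm {s : ℂ} (hs : 0 < s.re) (him : 0 < s.im) :
    DifferentiableAt ℂ (fun s => ∑' k : ℕ, zetaTerm (k + 1) s) s := by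
  set V : Set ℂ := {w | s.re / 2 < w.re} ∩ {w | 0 < w.im} ∩ {w | ‖w‖ < ‖s‖ + 1}
  have hV : IsOpen V := ((isOpen_lt continuous_const Complex.continuous_re).inter
    (isOpen_lt continuous_const Complex.continuous_im)).inter
    (isOpen_lt continuous_norm continuous_const)
  have hsV : s ∈ V := ⟨⟨by simp only [mem_ofPred_eq]; linarith, him⟩, by simp⟩
  have hne : ∀ w ∈ V, w ≠ 1 := by
    rintro w ⟨⟨-, h⟩, -⟩ rfl; simp at h
  refine DifferentiableOn.differentiableAt (s := V) ?_ (hV.mem_nhds hsV)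
  refine Complex.differentiableOn_tsum_of_summable_norm
    (u := fun k : ℕ => (‖s‖ + 1) * ((k + 1 : ℕ) : ℝ) ^ (-(s.re / 2 + 1)))
    ((summable_nat_add_one_rpow (by linarith)).mul_left _)
    (fun k w hw => (differentiableAt_zetaTerm (by lia) (hne w hw)).differentiableWithinAt) hV ?_
  rintro k w hw
  have hw' := hw
  obtain ⟨⟨h1, h2⟩, h3⟩ := hw'
  simp only [mem_ofPred_eq] at h1 h2 h3
  refine (norm_zetaTerm_le (by lia) (by linarith) (hne w hw)).trans ?_
  have : (1 : ℝ) ≤ ((k + 1 : ℕ) : ℝ) := by exact_mod_cast (by lia : 1 ≤ k + 1)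
  gcongr
  linarith

/-- Identity theorem on the open first quadrant, which is convex, avoids the pole and meets the
half-plane of absolute convergence. -/
theorem riemannZeta_eq_tsum_zetaTerm {s : ℂ} (hs : 0 < s.re) (him : 0 < s.im) :
    riemannZeta s = 1 / (s - 1) + ∑' k : ℕ, zetaTerm (k + 1) s := by
  set U : Set ℂ := {w | 0 < w.re} ∩ {w | 0 < w.im}
  have hU : IsOpen U := (isOpen_lt continuous_const Complex.continuous_re).inter
    (isOpen_lt continuous_const Complex.continuous_im)
  have hUc : IsPreconnected U :=
    ((convex_halfSpace_re_gt 0).inter (convex_halfSpace_im_gt 0)).isPreconnected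
  have hne : ∀ w ∈ U, w ≠ 1 := by
    rintro w ⟨-, h⟩ rfl; simp at h
  have hf : AnalyticOnNhd ℂ riemannZeta U := fun w hw => analyticOn_riemannZeta w (hne w hw)
  have hg : AnalyticOnNhd ℂ (fun s => 1 / (s - 1) + ∑' k : ℕ, zetaTerm (k + 1) s) U := by
    refine DifferentiableOn.analyticOnNhd (fun w hw => DifferentiableAt.differentiableWithinAt ?_) hU
    have hw1 : DifferentiableAt ℂ (fun s : ℂ => 1 / (s - 1)) w :=
      DifferentiableAt.div (by fun_prop) (by fun_prop) (sub_ne_zero.2 (hne w hw))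
    exact hw1.add (differentiableAt_tsum_zetaTerm hw.1 hw.2)
  have h2 : (2 + Complex.I) ∈ U := by simp [U]
  refine hf.eqOn_of_preconnected_of_eventuallyEq hg hUc h2 ?_ ⟨hs, him⟩
  have : {w : ℂ | 1 < w.re} ∈ 𝓝 (2 + Complex.I) :=
    (isOpen_lt continuous_const Complex.continuous_re).mem_nhds (by simp)
  filter_upwards [this] with w hw
  exact riemannZeta_eq_tsum_zetaTerm_of_one_lt hw

theorem riemannZeta_eq_sum_add {s : ℂ} (hs : 0 < s.re) (him : 0 < s.im) (N : ℕ) :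
    riemannZeta s = ∑ k ∈ Finset.range N, ((k + 1 : ℕ) : ℂ) ^ (-s) +
      ((N + 1 : ℕ) : ℂ) ^ (1 - s) / (s - 1) + ∑' k : ℕ, zetaTerm (k + N + 1) s := by
  have hs1 : s ≠ 1 := by rintro rfl; simp at him
  have a1 : s - 1 ≠ 0 := sub_ne_zero.2 hs1
  have a2 : 1 - s ≠ 0 := sub_ne_zero.2 hs1.symm
  rw [riemannZeta_eq_tsum_zetaTerm hs him, ← (summable_zetaTerm hs hs1).sum_add_tsum_nat_add N,
    sum_range_zetaTerm, ← neg_sub s 1]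
  field_simp
  ring

/-- Cutting the series at M, with |s| ≤ 5M, bounds the partial sum, the boundary term and the tail
by the same power of M. The slack η is spent on the convergent series ∑ k^(−1−η). -/
theorem norm_riemannZeta_le_of_im_le {η : ℝ} (hη : 0 < η) {s : ℂ} (hs : η ≤ s.re) (him : 1 ≤ s.im)
    {M : ℕ} (hM : 1 ≤ M) (hsM : ‖s‖ ≤ 5 * M) :
    ‖riemannZeta s‖ ≤ (6 * (∑' k : ℕ, ((k + 1 : ℕ) : ℝ) ^ (-(1 + η))) + 1) *
      (M : ℝ) ^ (max (1 - s.re) 0 + η) := by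
  obtain ⟨N, rfl⟩ : ∃ N, M = N + 1 := ⟨M - 1, by lia⟩
  have hs0 : 0 < s.re := hη.trans_le hs
  have him0 : 0 < s.im := by linarith
  have hs1 : s ≠ 1 := by rintro rfl; simp at him0
  have hsum := summable_nat_add_one_rpow (p := 1 + η) (by linarith)
  set C := ∑' k : ℕ, ((k + 1 : ℕ) : ℝ) ^ (-(1 + η)) with hC
  set e := max (1 - s.re) 0 with he
  have hM1 : (1 : ℝ) ≤ ((N + 1 : ℕ) : ℝ) := by exact_mod_cast hM
  have hM0 : (0 : ℝ) < ((N + 1 : ℕ) : ℝ) := by linarith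
  have he0 : 0 ≤ e := le_max_right _ _
  have he1 : 1 - s.re ≤ e := le_max_left _ _
  rw [riemannZeta_eq_sum_add hs0 him0 N]
  have b1 : ‖∑ k ∈ Finset.range N, ((k + 1 : ℕ) : ℂ) ^ (-s)‖ ≤ ((N + 1 : ℕ) : ℝ) ^ (e + η) * C := by
    calc _ ≤ ∑ k ∈ Finset.range N, ((N + 1 : ℕ) : ℝ) ^ (e + η) * ((k + 1 : ℕ) : ℝ) ^ (-(1 + η)) := by
          refine norm_sum_le_of_le _ fun k hk => ?_
          have hkN : ((k + 1 : ℕ) : ℝ) ≤ ((N + 1 : ℕ) : ℝ) := by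
            have := Finset.mem_range.1 hk; exact_mod_cast (by lia : k + 1 ≤ N + 1)
          have hk1 : (1 : ℝ) ≤ ((k + 1 : ℕ) : ℝ) := by exact_mod_cast (by lia : 1 ≤ k + 1)
          have hk0 : (0 : ℝ) < ((k + 1 : ℕ) : ℝ) := by linarith
          rw [Complex.norm_natCast_cpow_of_pos (by lia)]
          calc ((k + 1 : ℕ) : ℝ) ^ (-s).re = ((k + 1 : ℕ) : ℝ) ^ (1 - s.re + η) * ((k + 1 : ℕ) : ℝ) ^ (-(1 + η)) := by
                rw [← Real.rpow_add hk0]; congr 1; simp; ring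
            _ ≤ ((N + 1 : ℕ) : ℝ) ^ (e + η) * ((k + 1 : ℕ) : ℝ) ^ (-(1 + η)) := by
                gcongr
                calc _ ≤ ((k + 1 : ℕ) : ℝ) ^ (e + η) := by gcongr 1; gcongr
                  _ ≤ _ := by gcongr
      _ ≤ _ := by
          rw [← Finset.mul_sum]
          gcongr
          exact hsum.sum_le_tsum _ (fun k _ => by positivity)
  have b2 : ‖((N + 1 : ℕ) : ℂ) ^ (1 - s) / (s - 1)‖ ≤ ((N + 1 : ℕ) : ℝ) ^ (e + η) := by
    have h1 : 1 ≤ ‖s - 1‖ := by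
      have := Complex.abs_im_le_norm (s - 1)
      simp only [Complex.sub_im, Complex.one_im, sub_zero] at this
      linarith [le_abs_self s.im]
    rw [norm_div, Complex.norm_natCast_cpow_of_pos (by lia)]
    refine (div_le_self (by positivity) h1).trans ?_
    refine Real.rpow_le_rpow_of_exponent_le hM1 ?_
    simp only [Complex.sub_re, Complex.one_re]; linarith
  have b3 : ‖∑' k : ℕ, zetaTerm (k + N + 1) s‖ ≤ 5 * (((N + 1 : ℕ) : ℝ) ^ (e + η) * C) := by
    have hb : ∀ k : ℕ, ‖zetaTerm (k + N + 1) s‖ ≤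
        ‖s‖ * ((N + 1 : ℕ) : ℝ) ^ (η - s.re) * ((k + 1 : ℕ) : ℝ) ^ (-(1 + η)) := by
      intro k
      refine (norm_zetaTerm_le (by lia) hs0 hs1).trans ?_
      have hk1 : ((N + 1 : ℕ) : ℝ) ≤ ((k + N + 1 : ℕ) : ℝ) := by exact_mod_cast (by lia)
      have hk0 : (0 : ℝ) < ((k + N + 1 : ℕ) : ℝ) := by linarith
      have hk2 : ((k + 1 : ℕ) : ℝ) ≤ ((k + N + 1 : ℕ) : ℝ) := by exact_mod_cast (by lia)
      rw [mul_assoc]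
      gcongr
      calc ((k + N + 1 : ℕ) : ℝ) ^ (-s.re - 1)
          = ((k + N + 1 : ℕ) : ℝ) ^ (η - s.re) * ((k + N + 1 : ℕ) : ℝ) ^ (-(1 + η)) := by
            rw [← Real.rpow_add hk0]; congr 1; ring
        _ ≤ _ := by
            refine mul_le_mul (Real.rpow_le_rpow_of_nonpos hM0 hk1 (by linarith))
              (Real.rpow_le_rpow_of_nonpos (by positivity) hk2 (by linarith)) (by positivity) (by positivity)
    refine (tsum_of_norm_bounded (hsum.mul_left _).hasSum hb).trans ?_
    rw [tsum_mul_left, ← hC]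
    have hC0 : 0 ≤ C := tsum_nonneg fun k => by positivity
    calc ‖s‖ * ((N + 1 : ℕ) : ℝ) ^ (η - s.re) * C
        ≤ (5 * ((N + 1 : ℕ) : ℝ)) * ((N + 1 : ℕ) : ℝ) ^ (η - s.re) * C := by gcongr
      _ = 5 * (((N + 1 : ℕ) : ℝ) ^ (1 - s.re + η) * C) := by
          rw [show 1 - s.re + η = 1 + (η - s.re) by ring, Real.rpow_add hM0, Real.rpow_one]; ring
      _ ≤ _ := by gcongr
  calc _ ≤ ((N + 1 : ℕ) : ℝ) ^ (e + η) * C + ((N + 1 : ℕ) : ℝ) ^ (e + η) +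
        5 * (((N + 1 : ℕ) : ℝ) ^ (e + η) * C) := (norm_add₃_le).trans (by gcongr)
    _ = _ := by ring

/-- Growth of `ζ` to the right of the imaginary axis. -/
theorem exists_norm_riemannZeta_le {η : ℝ} (hη : 0 < η) (hη1 : η < 1) :
    ∃ C : ℝ, 1 ≤ C ∧ ∀ T : ℝ, 2 ≤ T → ∀ s : ℂ, η ≤ s.re → s.re ≤ 3 → |s.im - T| ≤ 1 →
      ‖riemannZeta s‖ ≤ C * T ^ (max (1 - s.re) 0 + η) := by
  set C := ∑' k : ℕ, ((k + 1 : ℕ) : ℝ) ^ (-(1 + η))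
  have hC0 : 0 ≤ C := tsum_nonneg fun k => by positivity
  refine ⟨4 * (6 * C + 1), by linarith, fun T hT s hs hs3 him => ?_⟩
  obtain ⟨h1, h2⟩ := abs_le.1 him
  have hM := Nat.le_ceil T
  have hM2 : (⌈T⌉₊ : ℝ) ≤ 2 * T := by have := Nat.ceil_lt_add_one (show 0 ≤ T by linarith); linarith
  have hM1 : 1 ≤ ⌈T⌉₊ := Nat.one_le_ceil_iff.2 (by linarith)
  have hsn : ‖s‖ ≤ 5 * (⌈T⌉₊ : ℝ) := by
    refine (Complex.norm_le_abs_re_add_abs_im s).trans ?_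
    rw [abs_of_pos (hη.trans_le hs), abs_of_pos (by linarith)]
    linarith
  refine (norm_riemannZeta_le_of_im_le hη hs (by linarith) hM1 hsn).trans ?_
  have he : max (1 - s.re) 0 + η ≤ 2 := by
    rcases max_cases (1 - s.re) 0 with h | h <;> linarith
  have he0 : 0 ≤ max (1 - s.re) 0 + η := add_nonneg (le_max_right _ _) hη.le
  calc _ ≤ (6 * C + 1) * (2 * T) ^ (max (1 - s.re) 0 + η) := by gcongr
    _ = (6 * C + 1) * (2 ^ (max (1 - s.re) 0 + η) * T ^ (max (1 - s.re) 0 + η)) := by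
        rw [Real.mul_rpow (by norm_num) (by linarith)]
    _ ≤ (6 * C + 1) * (4 * T ^ (max (1 - s.re) 0 + η)) := by
        gcongr
        calc (2 : ℝ) ^ (max (1 - s.re) 0 + η) ≤ 2 ^ (2 : ℝ) := by gcongr; norm_num
          _ = 4 := by norm_num
    _ = _ := by ring

/-- The inverse 1/ζ is the Dirichlet series of the Möbius function, so it is bounded by ∑ n^(−σ). -/
theorem exists_le_norm_riemannZeta {σ : ℝ} (hσ : 1 < σ) :
    ∃ c : ℝ, 0 < c ∧ c ≤ 1 ∧ ∀ s : ℂ, s.re = σ → c ≤ ‖riemannZeta s‖ := by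
  have hsum := summable_nat_add_one_rpow hσ
  set C := ∑' k : ℕ, ((k + 1 : ℕ) : ℝ) ^ (-σ)
  have hC1 : 1 ≤ C := by
    have := hsum.le_tsum 0 (fun k _ => by positivity)
    simpa [C] using this
  refine ⟨1 / C, by positivity, (div_le_one (by linarith)).2 hC1, fun s hs => ?_⟩
  have hs1 : 1 < s.re := hs ▸ hσ
  have hmul := ArithmeticFunction.LSeries_zeta_mul_Lseries_moebius hs1
  rw [ArithmeticFunction.LSeries_zeta_eq_riemannZeta hs1] at hmul
  have hmu : ‖LSeries (fun n => (ArithmeticFunction.moebius n : ℂ)) s‖ ≤ C := by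
    rw [LSeries]
    have hS : Summable fun n : ℕ => (n : ℝ) ^ (-σ) := Real.summable_nat_rpow.2 (by linarith)
    refine (tsum_of_norm_bounded (g := fun n : ℕ => (n : ℝ) ^ (-σ)) hS.hasSum fun n => ?_).trans ?_
    · rcases Nat.eq_zero_or_pos n with rfl | hn
      · simp; positivity
      · rw [LSeries.norm_term_eq, if_neg hn.ne', hs, Real.rpow_neg (by positivity), div_eq_mul_inv]
        refine mul_le_of_le_one_left (by positivity) ?_
        have : |ArithmeticFunction.moebius n| ≤ 1 := ArithmeticFunction.abs_moebius_le_one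
        rw [Complex.norm_intCast]
        exact_mod_cast this
    · rw [hS.tsum_eq_zero_add]
      simp [Real.zero_rpow (by linarith : -σ ≠ 0), C]
  have := congrArg norm hmul
  rw [norm_mul, norm_one] at this
  rw [div_le_iff₀ (by linarith)]
  rw [← this]
  gcongr

/-! ### Growth of Γ, and the sign of Re (ζ'/ζ) on the critical line. -/

/-- Each term is at most 1/(j + J + 1), which telescopes against the logarithm, plus (J + 2)/(j² +
y²), which telescopes against 1/(y + j − 1). The hypothesis on y makes the second total at most 1.
-/
theorem sum_range_div_sq_add_sq_le {J y : ℝ} (hJ : 1 ≤ J) (hy : 2 * J + 5 ≤ y) (n : ℕ) :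
    ∑ j ∈ Finset.range n, ((j : ℝ) + 1) / ((j : ℝ) ^ 2 + y ^ 2) ≤
      Real.log (n + J) - Real.log J + 1 := by
  have hy0 : 0 < y := by linarith
  have key : ∑ j ∈ Finset.range n, ((j : ℝ) + 1) / ((j : ℝ) ^ 2 + y ^ 2) ≤
      Real.log (n + J) - Real.log J + 2 * (J + 2) * (1 / (y - 1) - 1 / (y + n - 1)) := by
    induction n with
    | zero => simp
    | succ n ih =>
      rw [Finset.sum_range_succ]
      have hn : (0 : ℝ) ≤ n := Nat.cast_nonneg n
      have h1 : ((n : ℝ) + 1) / ((n : ℝ) ^ 2 + y ^ 2) ≤ 1 / (n + J + 1) + (J + 2) / ((n : ℝ) ^ 2 + y ^ 2) := by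
        rw [div_add_div _ _ (by positivity) (by positivity), div_le_div_iff₀ (by positivity) (by positivity)]
        have : ((n : ℝ) + 1) * (n + J + 1) ≤ 1 * ((n : ℝ) ^ 2 + y ^ 2) + (n + J + 1) * (J + 2) := by
          nlinarith [sq_nonneg y]
        calc _ = (((n : ℝ) + 1) * (n + J + 1)) * ((n : ℝ) ^ 2 + y ^ 2) := by ring
          _ ≤ _ := by gcongr
      have h2 : 1 / (n + J + 1) ≤ Real.log (n + J + 1) - Real.log (n + J) := by
        rw [← Real.log_div (by positivity) (by positivity)]
        refine le_trans (le_of_eq ?_) (Real.one_sub_inv_le_log_of_pos (by positivity))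
        field_simp
        ring
      have h3 : (J + 2) / ((n : ℝ) ^ 2 + y ^ 2) ≤ 2 * (J + 2) * (1 / (y + n - 1) - 1 / (y + n)) := by
        have p1 : 0 < y + n - 1 := by linarith
        have p2 : 0 < y + n := by linarith
        rw [div_sub_div _ _ p1.ne' p2.ne', mul_div_assoc', div_le_div_iff₀ (by positivity) (by positivity)]
        have : (y + n - 1) * (y + n) ≤ 2 * ((n : ℝ) ^ 2 + y ^ 2) := by nlinarith [sq_nonneg (y - n)]
        calc _ ≤ (J + 2) * (2 * ((n : ℝ) ^ 2 + y ^ 2)) := by gcongr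
          _ = _ := by ring
      push_cast
      have e1 : (n : ℝ) + 1 + J = n + J + 1 := by ring
      have e2 : y + ((n : ℝ) + 1) - 1 = y + n := by ring
      rw [e1, e2]
      linarith
  refine key.trans ?_
  have hn : (0 : ℝ) ≤ n := Nat.cast_nonneg n
  have p1 : 0 < y + n - 1 := by linarith
  have p2 : 0 < 1 / (y + n - 1) := by positivity
  have h4 : 2 * (J + 2) * (1 / (y - 1)) ≤ 1 := by
    rw [mul_one_div, div_le_one (by linarith)]; linarith
  nlinarith

/-- The shift by a raises the squared modulus by at most 2a(j + 1), and 1 + x ≤ exp x absorbs this.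
-/
theorem norm_add_natCast_add_le {s : ℂ} {a : ℝ} (ha : 0 ≤ a) (hs : 0 ≤ s.re) (hsa : s.re + a ≤ 1)
    (hy : 0 < s.im) (j : ℕ) :
    ‖s + a + j‖ ≤ Real.exp (a * (((j : ℝ) + 1) / ((j : ℝ) ^ 2 + s.im ^ 2))) * ‖s + j‖ := by
  have hj : (0 : ℝ) ≤ j := Nat.cast_nonneg j
  refine le_of_sq_le_sq ?_ (by positivity)
  rw [mul_pow, ← Real.exp_nat_mul, Complex.sq_norm, Complex.sq_norm, Complex.normSq_apply, Complex.normSq_apply]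
  simp only [Complex.add_re, Complex.add_im, Complex.ofReal_re, Complex.ofReal_im, Complex.natCast_re,
    Complex.natCast_im, add_zero]
  have hD : 0 < (j : ℝ) ^ 2 + s.im ^ 2 := by positivity
  set q := ((j : ℝ) + 1) / ((j : ℝ) ^ 2 + s.im ^ 2)
  have hq : 0 ≤ q := by positivity
  have h1 : 1 + 2 * (a * q) ≤ Real.exp ((2 : ℕ) * (a * q)) := by
    have := Real.add_one_le_exp ((2 : ℕ) * (a * q)); push_cast at this ⊢; linarith
  have h2 : (j : ℝ) + 1 ≤ q * ((s.re + j) * (s.re + j) + s.im * s.im) := by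
    calc (j : ℝ) + 1 = q * ((j : ℝ) ^ 2 + s.im ^ 2) := by simp only [q]; field_simp
      _ ≤ _ := by gcongr <;> nlinarith
  calc (s.re + a + j) * (s.re + a + j) + s.im * s.im
      ≤ ((s.re + j) * (s.re + j) + s.im * s.im) + 2 * a * (j + 1) := by nlinarith
    _ ≤ ((s.re + j) * (s.re + j) + s.im * s.im) +
        2 * a * (q * ((s.re + j) * (s.re + j) + s.im * s.im)) := by gcongr
    _ = (1 + 2 * (a * q)) * ((s.re + j) * (s.re + j) + s.im * s.im) := by ring
    _ ≤ _ := by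
      have : 0 ≤ (s.re + j) * (s.re + j) + s.im * s.im := by positivity
      gcongr

/-- In Gauss's product the shift from s to s + a gains N^a and loses at most exp (a (log (N + 1 + J)
− log J + 1)); as N → ∞ the factor (J/e)^a survives. As J is free, this gain can be made large at
large height without Stirling's formula. -/
theorem exp_mul_norm_Gamma_le {J a : ℝ} (hJ : 1 ≤ J) {s : ℂ} (ha : 0 ≤ a) (hs : 0 ≤ s.re)
    (hsa : s.re + a ≤ 1) (hy : 2 * J + 5 ≤ s.im) :
    Real.exp (a * (Real.log J - 1)) * ‖Complex.Gamma s‖ ≤ ‖Complex.Gamma (s + a)‖ := by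
  have hy0 : 0 < s.im := by linarith
  have hlim : Tendsto (fun N : ℕ => Real.log N - Real.log (N + 1 + J)) atTop (𝓝 0) := by
    have h1 : Tendsto (fun N : ℕ => (N : ℝ) / (N + (1 + J))) atTop (𝓝 1) :=
      tendsto_natCast_div_add_atTop (1 + J)
    have h2 := (Real.continuousAt_log one_ne_zero).tendsto.comp h1
    rw [Real.log_one] at h2
    refine h2.congr' ?_
    filter_upwards [eventually_gt_atTop 0] with N hN
    have hN' : (0 : ℝ) < N := by exact_mod_cast hN
    simp only [Function.comp]
    rw [Real.log_div hN'.ne' (by positivity), add_assoc]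
  have hL : Tendsto (fun N : ℕ => Real.exp (a * (Real.log N - Real.log (N + 1 + J) + (Real.log J - 1))) *
      ‖Complex.GammaSeq s N‖) atTop (𝓝 (Real.exp (a * (0 + (Real.log J - 1))) * ‖Complex.Gamma s‖)) :=
    ((Real.continuous_exp.tendsto _).comp ((hlim.add_const _).const_mul a)).mul
      (Complex.GammaSeq_tendsto_Gamma s).norm
  rw [zero_add] at hL
  refine le_of_tendsto_of_tendsto hL (Complex.GammaSeq_tendsto_Gamma (s + a)).norm ?_
  filter_upwards [eventually_gt_atTop 0] with N hN
  have hN' : (0 : ℝ) < N := by exact_mod_cast hN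
  have hne : ∀ j : ℕ, 0 < ‖s + j‖ := fun j => norm_pos_iff.2 fun h => by
    have := congrArg Complex.im h; simp at this; linarith
  have hne' : ∀ j : ℕ, 0 < ‖s + a + j‖ := fun j => norm_pos_iff.2 fun h => by
    have := congrArg Complex.im h; simp at this; linarith
  have hprod : ∏ j ∈ Finset.range (N + 1), ‖s + a + j‖ ≤
      Real.exp (a * (Real.log (N + 1 + J) - Real.log J + 1)) * ∏ j ∈ Finset.range (N + 1), ‖s + j‖ := by
    calc _ ≤ ∏ j ∈ Finset.range (N + 1),
          (Real.exp (a * (((j : ℝ) + 1) / ((j : ℝ) ^ 2 + s.im ^ 2))) * ‖s + j‖) :=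
          Finset.prod_le_prod (fun j _ => norm_nonneg _) fun j _ => norm_add_natCast_add_le ha hs hsa hy0 j
      _ ≤ _ := by
          rw [Finset.prod_mul_distrib, ← Real.exp_sum, ← Finset.mul_sum]
          have := sum_range_div_sq_add_sq_le hJ hy (N + 1)
          push_cast at this
          have h0 : 0 ≤ ∏ j ∈ Finset.range (N + 1), ‖s + j‖ := Finset.prod_nonneg fun j _ => norm_nonneg _
          gcongr
  have hp1 : 0 < ∏ j ∈ Finset.range (N + 1), ‖s + j‖ := Finset.prod_pos fun j _ => hne j
  have hp2 : 0 < ∏ j ∈ Finset.range (N + 1), ‖s + a + j‖ := Finset.prod_pos fun j _ => hne' j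
  simp only [Complex.GammaSeq, norm_div, norm_mul, norm_prod]
  rw [Complex.norm_natCast_cpow_of_pos hN, Complex.norm_natCast_cpow_of_pos hN, Complex.add_re,
    Complex.ofReal_re, Real.rpow_add hN', mul_div_assoc', div_le_div_iff₀ hp1 hp2]
  have e1 : (N : ℝ) ^ a = Real.exp (a * (Real.log N - Real.log (N + 1 + J) + (Real.log J - 1))) *
      Real.exp (a * (Real.log (N + 1 + J) - Real.log J + 1)) := by
    rw [← Real.exp_add, Real.rpow_def_of_pos hN']; congr 1; ring
  rw [e1]
  calc _ ≤ Real.exp (a * (Real.log N - Real.log (N + 1 + J) + (Real.log J - 1))) *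
        ((N : ℝ) ^ s.re * ‖(N.factorial : ℂ)‖) *
        (Real.exp (a * (Real.log (N + 1 + J) - Real.log J + 1)) * ∏ j ∈ Finset.range (N + 1), ‖s + j‖) := by
        gcongr
    _ = _ := by ring

theorem norm_Gammaℝ (s : ℂ) :
    ‖s.Gammaℝ‖ = Real.pi ^ (-s.re / 2) * ‖Complex.Gamma (s / 2)‖ := by
  rw [Complex.Gammaℝ, norm_mul, Complex.norm_cpow_eq_rpow_re_of_pos Real.pi_pos]
  congr 2
  simp [neg_div]

theorem norm_Gammaℝ_conj (s : ℂ) : ‖(starRingEnd ℂ s).Gammaℝ‖ = ‖s.Gammaℝ‖ := by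
  have : starRingEnd ℂ s / 2 = starRingEnd ℂ (s / 2) := by
    rw [map_div₀, Complex.conj_ofNat]
  rw [norm_Gammaℝ, norm_Gammaℝ, this, Complex.Gamma_conj]
  simp

theorem norm_riemannZeta_one_sub_conj {s : ℂ} (h0 : 0 < s.re) (h1 : s.re < 1) :
    ‖riemannZeta (1 - starRingEnd ℂ s)‖ * ‖(1 - starRingEnd ℂ s).Gammaℝ‖ =
      ‖riemannZeta s‖ * ‖s.Gammaℝ‖ := by
  have h1' : 0 < (1 - s).re := by simpa using h1
  have hs0 : s ≠ 0 := by rintro rfl; simp at h0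
  have hs1 : 1 - s ≠ 0 := by intro h; simp [h] at h1'
  have e : 1 - starRingEnd ℂ s = starRingEnd ℂ (1 - s) := by simp
  rw [e, riemannZeta_conj, norm_Gammaℝ_conj, RCLike.norm_conj, ← norm_mul, ← norm_mul,
    riemannZeta_def_of_ne_zero hs0, riemannZeta_def_of_ne_zero hs1,
    div_mul_cancel₀ _ (Complex.Gammaℝ_ne_zero_of_re_pos h0),
    div_mul_cancel₀ _ (Complex.Gammaℝ_ne_zero_of_re_pos h1'), completedRiemannZeta_one_sub]

theorem exists_exp_mul_norm_riemannZeta_le :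
    ∃ t₀ : ℝ, 1 ≤ t₀ ∧ ∀ t : ℝ, t₀ ≤ t → ∀ x : ℝ, 0 ≤ x → x ≤ 1 / 4 →
      Real.exp (2 * x) * ‖riemannZeta (1 / 2 + x + t * Complex.I)‖ ≤
        ‖riemannZeta (1 / 2 - x + t * Complex.I)‖ := by
  -- This makes log J − 1 = 2 + log π: the 2 is the exponent wanted, and log π pays for the power of
  -- π in `Gammaℝ`.
  set J : ℝ := Real.exp (3 + Real.log Real.pi) with hJ
  have hJ1 : 1 ≤ J := Real.one_le_exp (by have := Real.log_pos (show 1 < Real.pi by linarith [Real.pi_gt_three]); linarith)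
  refine ⟨2 * (2 * J + 5), by linarith, fun t ht x hx hx4 => ?_⟩
  set p : ℂ := 1 / 2 + x + t * Complex.I with hp
  set q : ℂ := 1 / 2 - x + t * Complex.I with hq
  have hpre : p.re = 1 / 2 + x := by simp [hp]
  have hqre : q.re = 1 / 2 - x := by simp [hq]
  have hqim : q.im = t := by simp [hq]
  have hpq : 1 - starRingEnd ℂ q = p := by
    apply Complex.ext
    · simp [hp, hq]; ring
    · simp [hp, hq]
  have hfe := norm_riemannZeta_one_sub_conj (s := q) (by rw [hqre]; linarith) (by rw [hqre]; linarith)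
  rw [hpq] at hfe
  have hG := exp_mul_norm_Gamma_le (s := q / 2) (a := x) hJ1 hx
    (by simp [hqre]; linarith) (by simp [hqre]; linarith) (by simp [hqim]; linarith)
  have hsum : q / 2 + x = p / 2 := by rw [hp, hq]; ring
  rw [hsum] at hG
  have hGR : Real.exp (2 * x) * ‖q.Gammaℝ‖ ≤ ‖p.Gammaℝ‖ := by
    rw [norm_Gammaℝ, norm_Gammaℝ, hpre, hqre]
    have e1 : Real.exp (2 * x) * Real.pi ^ (-(1 / 2 - x) / 2) =
        Real.pi ^ (-(1 / 2 + x) / 2) * Real.exp (x * (Real.log J - 1)) := by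
      rw [hJ, Real.log_exp, Real.rpow_def_of_pos Real.pi_pos, Real.rpow_def_of_pos Real.pi_pos,
        ← Real.exp_add, ← Real.exp_add]
      congr 1; ring
    calc _ = Real.pi ^ (-(1 / 2 + x) / 2) * (Real.exp (x * (Real.log J - 1)) * ‖Complex.Gamma (q / 2)‖) := by
          rw [← mul_assoc, e1, mul_assoc]
      _ ≤ _ := by gcongr
  have hGq : 0 < ‖q.Gammaℝ‖ :=
    norm_pos_iff.2 (Complex.Gammaℝ_ne_zero_of_re_pos (by rw [hqre]; linarith))
  refine le_of_mul_le_mul_right ?_ hGq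
  calc Real.exp (2 * x) * ‖riemannZeta p‖ * ‖q.Gammaℝ‖
      = ‖riemannZeta p‖ * (Real.exp (2 * x) * ‖q.Gammaℝ‖) := by ring
    _ ≤ ‖riemannZeta p‖ * ‖p.Gammaℝ‖ := by gcongr
    _ = _ := hfe

theorem HasDerivAt.nonneg_of_nonneg_right {f : ℝ → ℝ} {d a : ℝ} (hf : HasDerivAt f d 0) (h0 : f 0 = 0)
    (ha : 0 < a) (hpos : ∀ x, 0 ≤ x → x ≤ a → 0 ≤ f x) : 0 ≤ d := by
  have h1 := hf.tendsto_slope.mono_left (nhdsWithin_mono 0 (show Ioi (0:ℝ) ⊆ {0}ᶜ from fun x hx => (ne_of_gt hx)))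
  refine ge_of_tendsto h1 ?_
  filter_upwards [Ioc_mem_nhdsGT ha] with x hx
  rw [slope_def_field, h0]
  have := hpos x hx.1.le hx.2
  have := hx.1
  simp only [sub_zero]
  positivity

/-- The function |ζ(1/2 − x + it)|² − exp(4x) |ζ(1/2 + x + it)|² vanishes at x = 0 and is
nonnegative for small x ≥ 0. Its derivative at 0, which is −4 |ζ|² (Re (ζ'/ζ) + 1), is therefore
nonnegative. -/
theorem exists_re_logDeriv_riemannZeta_le :
    ∃ t₀ : ℝ, 1 ≤ t₀ ∧ ∀ t : ℝ, t₀ ≤ t → riemannZeta (1 / 2 + t * Complex.I) ≠ 0 →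
      (deriv riemannZeta (1 / 2 + t * Complex.I) / riemannZeta (1 / 2 + t * Complex.I)).re ≤ -1 := by
  obtain ⟨t₀, ht₀, h⟩ := exists_exp_mul_norm_riemannZeta_le
  refine ⟨t₀, ht₀, fun t ht hz => ?_⟩
  set s : ℂ := 1 / 2 + t * Complex.I with hs
  have hs1 : s ≠ 1 := by
    intro h; have := congrArg Complex.im h; simp [hs] at this; linarith
  have hd := (differentiableAt_riemannZeta hs1).hasDerivAt
  have hminus : HasDerivAt (fun x : ℝ => riemannZeta (1 / 2 - x + t * Complex.I)) (-(deriv riemannZeta s)) 0 := by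
    have ha : HasDerivAt (fun x : ℝ => (1 / 2 - x + t * Complex.I : ℂ)) (-1) 0 := by
      simpa using (((HasDerivAt.ofReal_comp (hasDerivAt_id (0 : ℝ))).const_sub (1 / 2 : ℂ)).add_const (t * Complex.I : ℂ))
    have hd' : HasDerivAt riemannZeta (deriv riemannZeta s) ((1 / 2 - (0 : ℝ) + t * Complex.I : ℂ)) := by
      simpa [hs] using hd
    exact (hd'.comp (0 : ℝ) ha).congr_deriv (by ring)
  have hplus : HasDerivAt (fun x : ℝ => riemannZeta (1 / 2 + x + t * Complex.I)) (deriv riemannZeta s) 0 := by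
    have ha : HasDerivAt (fun x : ℝ => (1 / 2 + x + t * Complex.I : ℂ)) 1 0 := by
      simpa using (((HasDerivAt.ofReal_comp (hasDerivAt_id (0 : ℝ))).const_add (1 / 2 : ℂ)).add_const (t * Complex.I : ℂ))
    have hd' : HasDerivAt riemannZeta (deriv riemannZeta s) ((1 / 2 + (0 : ℝ) + t * Complex.I : ℂ)) := by
      simpa [hs] using hd
    exact (hd'.comp (0 : ℝ) ha).congr_deriv (by ring)
  have hexp : HasDerivAt (fun x : ℝ => Real.exp (4 * x)) 4 0 := by
    simpa using ((hasDerivAt_id (0 : ℝ)).const_mul 4).exp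
  have hF := hminus.norm_sq.sub (hexp.mul hplus.norm_sq)
  have hpos := hF.nonneg_of_nonneg_right (a := 1 / 4) (by simp) (by norm_num) (fun x hx hx2 => by
    have h1 := h t ht x hx hx2
    have h2 : (Real.exp (2 * x) * ‖riemannZeta (1 / 2 + x + t * Complex.I)‖) ^ 2 ≤
        ‖riemannZeta (1 / 2 - x + t * Complex.I)‖ ^ 2 := by gcongr
    rw [mul_pow, ← Real.exp_nat_mul] at h2
    have e : ((2 : ℕ) : ℝ) * (2 * x) = 4 * x := by push_cast; ring
    rw [e] at h2
    simpa using h2)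
  simp only [Complex.ofReal_zero, sub_zero, add_zero, mul_zero, Real.exp_zero, one_mul, inner_neg_right] at hpos
  rw [← hs] at hpos
  have hn : 0 < ‖riemannZeta s‖ ^ 2 := by positivity
  have hinner : inner ℝ (riemannZeta s) (deriv riemannZeta s) =
      (deriv riemannZeta s / riemannZeta s).re * ‖riemannZeta s‖ ^ 2 := by
    rw [Complex.inner, Complex.div_re, Complex.sq_norm]
    have : Complex.normSq (riemannZeta s) ≠ 0 := by rwa [Ne, Complex.normSq_eq_zero]
    field_simp
    simp [Complex.mul_re]
  rw [hinner] at hpos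
  nlinarith

/-! ### Counting zeros with Jensen's formula. -/

theorem circleAverage_max_re (c : ℂ) :
    Real.circleAverage (fun z => max (c.re - z.re) 0) c 1 = 1 / Real.pi := by
  have hpi := Real.pi_pos
  have hcont : Continuous fun θ : ℝ => max (-Real.cos θ) 0 := by fun_prop
  have e : ∀ θ : ℝ, max (c.re - (circleMap c 1 θ).re) 0 = max (-Real.cos θ) 0 := by
    intro θ
    simp [circleMap, Complex.exp_ofReal_mul_I_re]
  have h1 : ∫ θ in (0 : ℝ)..(Real.pi / 2), max (-Real.cos θ) 0 = 0 := by
    rw [intervalIntegral.integral_congr (g := fun _ => (0 : ℝ)), intervalIntegral.integral_zero]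
    intro θ hθ
    rw [uIcc_of_le (by positivity)] at hθ
    have := Real.cos_nonneg_of_neg_pi_div_two_le_of_le (by linarith [hθ.1]) hθ.2
    simpa using this
  have h2 : ∫ θ in (Real.pi / 2)..(3 * Real.pi / 2), max (-Real.cos θ) 0 = 2 := by
    rw [intervalIntegral.integral_congr (g := fun θ => -Real.cos θ)]
    · rw [intervalIntegral.integral_neg, integral_cos, Real.sin_pi_div_two,
        show 3 * Real.pi / 2 = Real.pi / 2 + Real.pi by ring, Real.sin_add_pi, Real.sin_pi_div_two]
      norm_num
    · intro θ hθ
      rw [uIcc_of_le (by linarith)] at hθ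
      have := Real.cos_nonpos_of_pi_div_two_le_of_le hθ.1 (by linarith [hθ.2])
      simpa using this
  have h3 : ∫ θ in (3 * Real.pi / 2)..(2 * Real.pi), max (-Real.cos θ) 0 = 0 := by
    rw [intervalIntegral.integral_congr (g := fun _ => (0 : ℝ)), intervalIntegral.integral_zero]
    intro θ hθ
    rw [uIcc_of_le (by linarith)] at hθ
    have := Real.cos_nonneg_of_neg_pi_div_two_le_of_le (x := θ - 2 * Real.pi) (by linarith [hθ.1]) (by linarith [hθ.2])
    rw [Real.cos_sub_two_pi] at this
    simpa using this
  rw [Real.circleAverage_def]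
  simp only [e]
  rw [← intervalIntegral.integral_add_adjacent_intervals (b := 3 * Real.pi / 2)
      (hcont.intervalIntegrable _ _) (hcont.intervalIntegrable _ _),
    ← intervalIntegral.integral_add_adjacent_intervals (b := Real.pi / 2)
      (hcont.intervalIntegrable _ _) (hcont.intervalIntegrable _ _), h1, h2, h3]
  simp

/-- Jensen's formula with the zeros outside `Z` dropped; in a disc of radius 1 each of them
contributes a nonnegative amount. -/
theorem sum_analyticOrderNatAt_mul_log_le {f : ℂ → ℂ} {c : ℂ} (hf : AnalyticOnNhd ℂ f (closedBall c 1))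
    (hfc : f c ≠ 0) (Z : Finset ℂ) (hZ : ∀ a ∈ Z, a ∈ closedBall c 1) :
    ∑ a ∈ Z, (analyticOrderNatAt f a : ℝ) * Real.log (‖c - a‖⁻¹) + Real.log ‖f c‖ ≤
      Real.circleAverage (Real.log ‖f ·‖) c 1 := by
  have h1 : |(1 : ℝ)| = 1 := abs_one
  have hJ := AnalyticOnNhd.circleAverage_log_norm (R := 1) one_ne_zero (by rwa [h1]) hfc
  rw [hJ, h1]
  gcongr
  set D := MeromorphicOn.divisor f (closedBall c 1)
  have hDin : ∀ a ∈ closedBall c 1, D a = (analyticOrderNatAt f a : ℤ) := by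
    intro a ha
    simp only [D]
    rw [MeromorphicOn.AnalyticOnNhd.divisor_apply hf ha, analyticOrderNatAt]
    cases analyticOrderAt f a <;> simp
  have hnn : ∀ a, 0 ≤ (D a : ℝ) * Real.log (1 * ‖c - a‖⁻¹) := by
    intro a
    by_cases ha : a ∈ closedBall c 1
    · rw [hDin a ha]
      rw [mem_closedBall, dist_comm, dist_eq_norm] at ha
      refine mul_nonneg (by positivity) ?_
      rw [one_mul, Real.log_inv]
      linarith [Real.log_nonpos (norm_nonneg _) ha]
    · rw [Function.locallyFinsuppWithin.apply_eq_zero_of_notMem D ha]; simp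
  have hfin : (Function.support fun a => (D a : ℝ) * Real.log (1 * ‖c - a‖⁻¹)).Finite := by
    refine (D.finiteSupport (isCompact_closedBall c 1)).subset fun a ha => ?_
    simp only [Function.mem_support] at ha ⊢
    intro h0; rw [h0] at ha; simp at ha
  rw [finsum_eq_sum_of_support_subset (s := hfin.toFinset ∪ Z) _ (by intro a ha; simp; left; simpa using ha)]
  calc _ = ∑ a ∈ Z, (D a : ℝ) * Real.log (1 * ‖c - a‖⁻¹) := by
        refine Finset.sum_congr rfl fun a ha => ?_
        rw [hDin a (hZ a ha)]; simp
    _ ≤ _ := Finset.sum_le_sum_of_subset_of_nonneg Finset.subset_union_right fun a _ _ => hnn a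

/-- Write G = G(c) exp h with Re h ≤ M. Borel–Carathéodory bounds |h| on radius 0.8, and two Cauchy
estimates, each giving up 0.1 of radius, bound h' and h''. -/
theorem lipschitz_logDeriv_of_norm_le {G : ℂ → ℂ} {c : ℂ} {M : ℝ} (hM : 0 < M)
    (hG : DifferentiableOn ℂ G (ball c (9 / 10))) (hne : ∀ z ∈ ball c (9 / 10), G z ≠ 0)
    (hb : ∀ z ∈ ball c (9 / 10), ‖G z‖ ≤ Real.exp M * ‖G c‖) :
    ∀ z ∈ ball c (6 / 10), ∀ w ∈ ball c (6 / 10),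
      ‖logDeriv G z - logDeriv G w‖ ≤ 1600 * M * ‖z - w‖ := by
  have hcb : c ∈ ball c (9 / 10 : ℝ) := mem_ball_self (by norm_num)
  have hGc : 0 < ‖G c‖ := norm_pos_iff.2 (hne c hcb)
  have hL : DifferentiableOn ℂ (logDeriv G) (ball c (9 / 10)) := (hG.deriv isOpen_ball).div hG hne
  obtain ⟨h, hc0, hh⟩ := hL.isExactOn_ball.with_val_at c 0
  have hhd : DifferentiableOn ℂ h (ball c (9 / 10)) := fun w hw =>
    (hh w hw).differentiableAt.differentiableWithinAt
  have hconst : ∀ z ∈ ball c (9 / 10), G z * Complex.exp (-(h z)) = G c := by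
    intro z hz
    have := isOpen_ball.is_const_of_deriv_eq_zero (f := fun z => G z * Complex.exp (-(h z)))
      (convex_ball c (9 / 10)).isPreconnected
      (hG.mul hhd.neg.cexp)
      (fun w hw => by
        have h1 := (hG.differentiableAt (isOpen_ball.mem_nhds hw)).hasDerivAt
        refine (h1.mul (hh w hw).neg.cexp).deriv.trans ?_
        have := hne w hw
        simp only [logDeriv_apply, Pi.neg_apply, Pi.zero_apply]
        field_simp
        ring) hz hcb
    simpa [hc0] using this
  have hre : ∀ z ∈ ball c (9 / 10), (h z).re ≤ M := by
    intro z hz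
    have h1 := congrArg norm (hconst z hz)
    rw [norm_mul, Complex.norm_exp, Complex.neg_re, Real.exp_neg] at h1
    have h2 : ‖G z‖ = ‖G c‖ * Real.exp (h z).re := by rw [← h1]; field_simp
    have h3 := hb z hz
    rw [h2, mul_comm] at h3
    exact Real.exp_le_exp.1 (le_of_mul_le_mul_right h3 hGc)
  have hbound : ∀ z ∈ ball c (8 / 10), ‖h z‖ ≤ 16 * M := by
    intro z hz
    have hz' : z - c ∈ ball (0 : ℂ) (9 / 10) := by
      rw [mem_ball_zero_iff, ← dist_eq_norm]; rw [mem_ball] at hz; linarith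
    have hmap : ∀ w ∈ ball (0 : ℂ) (9 / 10), w + c ∈ ball c (9 / 10) := fun w hw => by
      rw [mem_ball_zero_iff] at hw; rw [mem_ball, dist_eq_norm]; simpa using hw
    have := Complex.borelCaratheodory_zero (f := fun w => h (w + c)) hM
      (fun w hw => ((hh _ (hmap w hw)).comp_add_const w c).differentiableAt.differentiableWithinAt)
      (fun w hw => hre _ (hmap w hw)) (by norm_num) hz' (by simpa using hc0)
    simp only [sub_add_cancel] at this
    refine this.trans ?_
    rw [mem_ball, dist_eq_norm] at hz
    rw [div_le_iff₀ (by linarith)]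
    nlinarith
  have hd1 : ∀ z ∈ ball c (7 / 10), ‖logDeriv G z‖ ≤ 160 * M := by
    intro z hz
    rw [mem_ball] at hz
    have hsub : closedBall z (1 / 10) ⊆ ball c (8 / 10) := fun w hw => by
      rw [mem_closedBall] at hw; rw [mem_ball]; linarith [dist_triangle w z c]
    have hsub' : closedBall z (1 / 10) ⊆ ball c (9 / 10) := hsub.trans (ball_subset_ball (by norm_num))
    have hdd : DifferentiableOn ℂ h (closedBall z (1 / 10)) := fun w hw =>
      (hh w (hsub' hw)).differentiableAt.differentiableWithinAt
    have := Complex.norm_deriv_le_of_forall_mem_sphere_norm_le (by norm_num) (hdd.diffContOnCl_ball subset_rfl)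
      (fun w hw => hbound w (hsub (sphere_subset_closedBall hw)))
    rw [(hh z (hsub' (mem_closedBall_self (by norm_num)))).deriv] at this
    linarith
  have hd2 : ∀ z ∈ ball c (6 / 10), ‖deriv (logDeriv G) z‖ ≤ 1600 * M := by
    intro z hz
    rw [mem_ball] at hz
    have hsub : closedBall z (1 / 10) ⊆ ball c (7 / 10) := fun w hw => by
      rw [mem_closedBall] at hw; rw [mem_ball]; linarith [dist_triangle w z c]
    have := Complex.norm_deriv_le_of_forall_mem_sphere_norm_le (by norm_num)
      ((hL.mono (hsub.trans (ball_subset_ball (by norm_num)))).diffContOnCl_ball subset_rfl)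
      (fun w hw => hd1 w (hsub (sphere_subset_closedBall hw)))
    linarith
  intro z hz w hw
  exact (convex_ball c (6 / 10)).norm_image_sub_le_of_norm_deriv_le
    (fun x hx => hL.differentiableAt (isOpen_ball.mem_nhds (ball_subset_ball (by norm_num) hx)))
    hd2 hw hz

theorem analyticOrderAt_riemannZeta_ne_top {z : ℂ} (hz : z ≠ 1) : analyticOrderAt riemannZeta z ≠ ⊤ := by
  refine analyticOn_riemannZeta.analyticOrderAt_ne_top_of_isPreconnected (x := 2)
    (isConnected_compl_singleton_of_one_lt_rank (by simp) 1).isPreconnected (by simp) hz ?_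
  rw [(analyticOn_riemannZeta 2 (by simp)).analyticOrderAt_eq_zero.2
    (riemannZeta_ne_zero_of_one_le_re (by simp))]
  simp

/-- The point `1 + η + iT` with `η = 1/1000`, to the right of the critical strip. -/
noncomputable def rightCenter (T : ℝ) : ℂ := 1001 / 1000 + T * Complex.I

@[simp] theorem rightCenter_re (T : ℝ) : (rightCenter T).re = 1001 / 1000 := by
  simp [rightCenter]

@[simp] theorem rightCenter_im (T : ℝ) : (rightCenter T).im = T := by
  simp [rightCenter]

theorem closedBall_rightCenter_bounds {T : ℝ} {z : ℂ} (hz : z ∈ closedBall (rightCenter T) 1) :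
    1 / 1000 ≤ z.re ∧ z.re ≤ 3 ∧ |z.im - T| ≤ 1 := by
  rw [mem_closedBall, dist_eq_norm] at hz
  have h1 := (Complex.abs_re_le_norm (z - rightCenter T)).trans hz
  have h2 := (Complex.abs_im_le_norm (z - rightCenter T)).trans hz
  simp only [Complex.sub_re, Complex.sub_im, rightCenter_re, rightCenter_im] at h1 h2
  obtain ⟨h3, h4⟩ := abs_le.1 h1
  exact ⟨by linarith, by linarith, h2⟩

theorem closedBall_rightCenter_subset {T : ℝ} (hT : 2 ≤ T) :
    closedBall (rightCenter T) 1 ⊆ {1}ᶜ := by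
  rintro z hz rfl
  obtain ⟨-, -, h⟩ := closedBall_rightCenter_bounds hz
  have := (abs_le.1 h).1
  simp at this
  linarith

/-- Jensen's bound for the zeros of `ζ` in a disc of radius `1` about `1 + η + iT`. -/
theorem exists_sum_order_mul_log_le :
    ∃ C : ℝ, ∀ T : ℝ, 2 ≤ T → ∀ Z : Finset ℂ, (∀ a ∈ Z, a ∈ closedBall (rightCenter T) 1) →
      ∑ a ∈ Z, (analyticOrderNatAt riemannZeta a : ℝ) * Real.log (‖rightCenter T - a‖⁻¹) ≤
        (1 / Real.pi + 1 / 1000) * Real.log T + C := by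
  obtain ⟨C, hC1, hC⟩ := exists_norm_riemannZeta_le (η := 1 / 1000) (by norm_num) (by norm_num)
  obtain ⟨c₀, hc0, -, hc⟩ := exists_le_norm_riemannZeta (σ := 1001 / 1000) (by norm_num)
  refine ⟨Real.log C - Real.log c₀, fun T hT Z hZ => ?_⟩
  set c := rightCenter T with hcdef
  have hT0 : 0 < T := by linarith
  have hℓ : 0 ≤ Real.log T := Real.log_nonneg (by linarith)
  have hcc := hc c (by simp [hcdef])
  have hf : AnalyticOnNhd ℂ riemannZeta (closedBall c 1) :=
    analyticOn_riemannZeta.mono (closedBall_rightCenter_subset hT)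
  have hJ := sum_analyticOrderNatAt_mul_log_le hf (norm_pos_iff.1 (hc0.trans_le hcc)) Z hZ
  have hlow : Real.log c₀ ≤ Real.log ‖riemannZeta c‖ := Real.log_le_log hc0 hcc
  have hg : CircleIntegrable (fun z : ℂ => max (c.re - z.re) 0) c 1 :=
    ContinuousOn.circleIntegrable' (by fun_prop)
  have hg' : CircleIntegrable (fun z : ℂ => Real.log T • max (c.re - z.re) 0) c 1 := hg.const_smul
  have hup : Real.circleAverage (Real.log ‖riemannZeta ·‖) c 1 ≤
      Real.circleAverage (fun z => (Real.log C + 1 / 1000 * Real.log T) +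
        Real.log T • max (c.re - z.re) 0) c 1 := by
    refine Real.circleAverage_mono ?_ ((circleIntegrable_const _ _ _).add hg') ?_
    · exact (hf.mono (by rw [abs_one]; exact sphere_subset_closedBall)).meromorphicOn.circleIntegrable_log_norm
    · intro z hz
      rw [abs_one] at hz
      obtain ⟨b1, b2, b3⟩ := closedBall_rightCenter_bounds (sphere_subset_closedBall hz)
      have hle := hC T hT z b1 b2 b3
      have hmax : max (1 - z.re) 0 ≤ max (c.re - z.re) 0 := by
        gcongr; simp [hcdef]; norm_num
      -- Zeros of ζ may lie on the circle; there the integrand is log 0 = 0, so the majorant has to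
      -- be nonnegative.
      have hrhs : 0 ≤ (Real.log C + 1 / 1000 * Real.log T) + Real.log T • max (c.re - z.re) 0 := by
        have := Real.log_nonneg hC1
        have : 0 ≤ max (c.re - z.re) 0 := le_max_right _ _
        simp only [smul_eq_mul]; positivity
      rcases eq_or_ne (riemannZeta z) 0 with h0 | h0
      · simpa [h0] using hrhs
      · calc Real.log ‖riemannZeta z‖ ≤ Real.log (C * T ^ (max (1 - z.re) 0 + 1 / 1000)) :=
              Real.log_le_log (norm_pos_iff.2 h0) hle
          _ = Real.log C + (max (1 - z.re) 0 + 1 / 1000) * Real.log T := by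
              rw [Real.log_mul (by linarith) (by positivity), Real.log_rpow hT0]
          _ ≤ Real.log C + (max (c.re - z.re) 0 + 1 / 1000) * Real.log T := by gcongr
          _ = _ := by simp only [smul_eq_mul]; ring
  rw [Real.circleAverage_fun_add (circleIntegrable_const _ _ _) hg',
    Real.circleAverage_const, Real.circleAverage_fun_smul, circleAverage_max_re, smul_eq_mul] at hup
  have e : Real.log T * (1 / Real.pi) = 1 / Real.pi * Real.log T := by ring
  linarith

theorem norm_rightCenter_sub_le {T : ℝ} {a : ℂ} {δ : ℝ} (ha : ‖a - (1 / 2 + Complex.I * T)‖ ≤ δ) :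
    ‖rightCenter T - a‖ ≤ 501 / 1000 + δ := by
  have e : rightCenter T - a = (501 / 1000 : ℝ) - (a - (1 / 2 + Complex.I * T)) := by
    rw [rightCenter]; push_cast; ring
  rw [e]
  refine (norm_sub_le _ _).trans (add_le_add ?_ ha)
  rw [Complex.norm_real]; norm_num

/-- The number of zeros of `ζ` close to `1/2 + iT`. -/
theorem exists_sum_order_le_near :
    ∃ T₀ : ℝ, 2 ≤ T₀ ∧ ∀ T : ℝ, T₀ ≤ T → ∀ Z : Finset ℂ,
      (∀ a ∈ Z, riemannZeta a = 0 ∧ ‖a - (1 / 2 + Complex.I * T)‖ ≤ 1 / 1000) →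
      ∑ a ∈ Z, (analyticOrderNatAt riemannZeta a : ℝ) ≤ 47 / 100 * Real.log T := by
  obtain ⟨C, hC⟩ := exists_sum_order_mul_log_le
  refine ⟨max 2 (Real.exp (1000 * C)), le_max_left _ _, fun T hT Z hZ => ?_⟩
  have hT2 : 2 ≤ T := (le_max_left _ _).trans hT
  have hTC : 1000 * C ≤ Real.log T := by
    rw [Real.le_log_iff_exp_le (by linarith)]; exact (le_max_right _ _).trans hT
  have hℓ : 0 ≤ Real.log T := Real.log_nonneg (by linarith)
  have h := hC T hT2 Z fun a ha => by
    rw [mem_closedBall, dist_comm, dist_eq_norm]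
    linarith [norm_rightCenter_sub_le (hZ a ha).2]
  -- The counted zeros lie within 0.501 + 0.001 of the centre, so each has weight at least 0.689 in
  -- Jensen's sum. The constant 0.47 exceeds (1/π + 0.002)/0.689, with `C` at most log T / 1000.
  have hlog : (689 / 1000 : ℝ) ≤ Real.log ((502 / 1000 : ℝ)⁻¹) := by
    have h1 : Real.log ((502 / 1000 : ℝ)⁻¹) = Real.log 2 - Real.log (1004 / 1000) := by
      rw [← Real.log_div (by norm_num) (by norm_num)]; norm_num
    have h2 := Real.log_le_sub_one_of_pos (show (0 : ℝ) < 1004 / 1000 by norm_num)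
    have h3 := Real.log_two_gt_d9
    rw [h1]; linarith
  have hlow : ∑ a ∈ Z, (analyticOrderNatAt riemannZeta a : ℝ) * (689 / 1000) ≤
      ∑ a ∈ Z, (analyticOrderNatAt riemannZeta a : ℝ) * Real.log (‖rightCenter T - a‖⁻¹) := by
    refine Finset.sum_le_sum fun a ha => ?_
    have h1 := norm_rightCenter_sub_le (hZ a ha).2
    have h2 : 0 < ‖rightCenter T - a‖ := by
      refine norm_pos_iff.2 (sub_ne_zero.2 ?_)
      intro h
      have := (hZ a ha).1
      rw [← h] at this
      exact riemannZeta_ne_zero_of_one_le_re (by simp; norm_num) this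
    gcongr
    refine hlog.trans (Real.log_le_log (by norm_num) ?_)
    gcongr
    linarith
  rw [← Finset.sum_mul] at hlow
  have hpi : 1 / Real.pi ≤ 0.31832 := by
    rw [div_le_iff₀ Real.pi_pos]
    have := Real.pi_gt_d4; linarith
  have : (1 / Real.pi + 1 / 1000) * Real.log T ≤ (0.31832 + 1 / 1000) * Real.log T := by gcongr
  linarith

/-- Any constant serves here: this count enters only the Lipschitz constant of the remainder, not
the exponent. -/
theorem exists_sum_order_le_far :
    ∃ K : ℝ, 0 ≤ K ∧ ∀ T : ℝ, 3 ≤ T → ∀ Z : Finset ℂ,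
      (∀ a ∈ Z, riemannZeta a = 0 ∧ a ∈ closedBall (rightCenter T) (9 / 10)) →
      ∑ a ∈ Z, (analyticOrderNatAt riemannZeta a : ℝ) ≤ K * Real.log T := by
  obtain ⟨C, hC⟩ := exists_sum_order_mul_log_le
  refine ⟨10 * (1 / Real.pi + 1 / 1000 + |C|), by positivity, fun T hT Z hZ => ?_⟩
  have hℓ : 1 ≤ Real.log T := by
    rw [Real.le_log_iff_exp_le (by linarith)]
    linarith [Real.exp_one_lt_d9]
  have h := hC T (by linarith) Z fun a ha => closedBall_subset_closedBall (by norm_num) (hZ a ha).2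
  have hlog : (1 / 10 : ℝ) ≤ Real.log ((9 / 10 : ℝ)⁻¹) := by
    have h2 := Real.log_le_sub_one_of_pos (show (0 : ℝ) < 9 / 10 by norm_num)
    rw [Real.log_inv]; linarith
  have hlow : ∑ a ∈ Z, (analyticOrderNatAt riemannZeta a : ℝ) * (1 / 10) ≤
      ∑ a ∈ Z, (analyticOrderNatAt riemannZeta a : ℝ) * Real.log (‖rightCenter T - a‖⁻¹) := by
    refine Finset.sum_le_sum fun a ha => ?_
    have h1 := (hZ a ha).2
    rw [mem_closedBall, dist_comm, dist_eq_norm] at h1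
    have h2 : 0 < ‖rightCenter T - a‖ := by
      refine norm_pos_iff.2 (sub_ne_zero.2 ?_)
      intro h
      have := (hZ a ha).1
      rw [← h] at this
      exact riemannZeta_ne_zero_of_one_le_re (by simp; norm_num) this
    gcongr
    refine hlog.trans (Real.log_le_log (by norm_num) ?_)
    gcongr
  rw [← Finset.sum_mul] at hlow
  have : C ≤ |C| * Real.log T := (le_abs_self C).trans (le_mul_of_one_le_right (abs_nonneg C) hℓ)
  linarith

/-- Near `1/2 + iT` the logarithmic derivative of `ζ` is a sum over the nearby zeros plus a function
with Lipschitz constant `O(log T)`. -/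
theorem exists_logDeriv_riemannZeta_eq :
    ∃ K : ℝ, 0 ≤ K ∧ ∀ T : ℝ, 3 ≤ T → ∃ Z : Finset ℂ, ∃ Q : ℂ → ℂ,
      (∀ a, a ∈ Z ↔ riemannZeta a = 0 ∧ ‖a - (1 / 2 + Complex.I * T)‖ ≤ 1 / 1000) ∧
      (∀ s ∈ ball (1 / 2 + Complex.I * T) (1 / 2000), riemannZeta s ≠ 0 →
        deriv riemannZeta s / riemannZeta s =
          ∑ a ∈ Z, (analyticOrderNatAt riemannZeta a : ℂ) * (1 / (s - a)) + Q s) ∧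
      ∀ s ∈ ball (1 / 2 + Complex.I * T) (1 / 2000), ∀ w ∈ ball (1 / 2 + Complex.I * T) (1 / 2000),
        ‖Q s - Q w‖ ≤ K * Real.log T * ‖s - w‖ := by
  obtain ⟨C, hC1, hC⟩ := exists_norm_riemannZeta_le (η := 1 / 1000) (by norm_num) (by norm_num)
  obtain ⟨c₀, hc0, hc01, hc⟩ := exists_le_norm_riemannZeta (σ := 1001 / 1000) (by norm_num)
  obtain ⟨K, hK0, hK⟩ := exists_sum_order_le_far
  have hlogC : 0 ≤ Real.log C := Real.log_nonneg hC1
  have hlogc : 0 ≤ -Real.log c₀ := by linarith [Real.log_nonpos hc0.le hc01]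
  set L := Real.log C - Real.log c₀ + 2 + 3 * K with hL
  have hL0 : 0 < L := by linarith
  refine ⟨1600 * L + 4000000 * K, by positivity, fun T hT => ?_⟩
  set c := rightCenter T with hcdef
  set s₀ : ℂ := 1 / 2 + Complex.I * T with hs0
  have hT0 : 0 < T := by linarith
  have hℓ : 1 ≤ Real.log T := by
    rw [Real.le_log_iff_exp_le (by linarith)]
    linarith [Real.exp_one_lt_d9]
  have hsub1 : closedBall c 1 ⊆ {1}ᶜ := closedBall_rightCenter_subset (by linarith)
  have hsub9 : closedBall c (9 / 10) ⊆ {1}ᶜ := (closedBall_subset_closedBall (by norm_num)).trans hsub1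
  have hZfin := finite_zeros_of_isCompact analyticOn_riemannZeta
    (fun z hz => analyticOrderAt_riemannZeta_ne_top hz) (isCompact_closedBall c (9 / 10)) hsub9
  set Z₁ := hZfin.toFinset with hZ1
  have hmemZ1 : ∀ a, a ∈ Z₁ ↔ a ∈ closedBall c (9 / 10) ∧ riemannZeta a = 0 := fun a => by
    simp [hZ1]
  obtain ⟨G, hG, hGZ, hzG⟩ := exists_eq_prod_mul analyticOn_riemannZeta
    (fun z hz => analyticOrderAt_riemannZeta_ne_top hz) Z₁ (fun a ha => hsub9 ((hmemZ1 a).1 ha).1)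
  set m := fun a => analyticOrderNatAt riemannZeta a with hm
  have hn : ∑ a ∈ Z₁, (m a : ℝ) ≤ K * Real.log T :=
    hK T hT Z₁ fun a ha => ((hmemZ1 a).1 ha).symm
  have hGne : ∀ z ∈ closedBall c (9 / 10), G z ≠ 0 := by
    intro z hz h0
    exact hGZ z ((hmemZ1 z).2 ⟨hz, by rw [hzG z, h0, mul_zero]⟩) h0
  have hzc := hc c (by simp [hcdef])
  have hGc : c₀ ≤ ‖G c‖ := by
    refine hzc.trans ?_
    rw [hzG c, norm_mul, norm_prod]
    refine mul_le_of_le_one_left (norm_nonneg _) (Finset.prod_le_one (fun _ _ => norm_nonneg _) fun a ha => ?_)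
    rw [norm_pow]
    refine pow_le_one₀ (norm_nonneg _) ?_
    have := ((hmemZ1 a).1 ha).1
    rw [mem_closedBall, dist_comm, dist_eq_norm] at this
    linarith
  -- The removed zeros lie within 9/10 of the centre, so on this circle every factor has modulus at
  -- least 1/20 > exp(−3) and dividing them out costs at most exp(3 K log T). The maximum principle
  -- carries the bound inside.
  have hGs : ∀ z ∈ sphere c (95 / 100), ‖G z‖ ≤ Real.exp (L * Real.log T) * ‖G c‖ := by
    intro z hz
    have hz1 : z ∈ closedBall c 1 := by rw [mem_sphere] at hz; rw [mem_closedBall]; linarith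
    obtain ⟨b1, b2, b3⟩ := closedBall_rightCenter_bounds hz1
    have hle : ‖riemannZeta z‖ ≤ C * T ^ (2 : ℝ) := by
      refine (hC T (by linarith) z b1 b2 b3).trans ?_
      gcongr
      · linarith
      · rcases max_cases (1 - z.re) 0 with h | h <;> linarith
    have hprod : Real.exp (-(3 * K * Real.log T)) ≤ ‖∏ a ∈ Z₁, (z - a) ^ m a‖ := by
      rw [norm_prod]
      calc Real.exp (-(3 * K * Real.log T)) ≤ Real.exp (∑ a ∈ Z₁, (m a : ℝ) * (-3)) := by
            rw [← Finset.sum_mul]; gcongr; linarith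
        _ = ∏ a ∈ Z₁, Real.exp (-3) ^ m a := by
            rw [Real.exp_sum]; refine Finset.prod_congr rfl fun a _ => ?_
            rw [← Real.exp_nat_mul]
        _ ≤ _ := by
            refine Finset.prod_le_prod (fun a _ => by positivity) fun a ha => ?_
            rw [norm_pow]
            gcongr
            have h1 := ((hmemZ1 a).1 ha).1
            rw [mem_closedBall, dist_eq_norm] at h1
            rw [mem_sphere, dist_eq_norm] at hz
            have h2 : ‖z - c‖ ≤ ‖z - a‖ + ‖a - c‖ := by
              simpa using norm_add_le (z - a) (a - c)
            have h3 : Real.exp (-3) ≤ 1 / 20 := by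
              rw [Real.exp_neg, inv_le_comm₀ (by positivity) (by norm_num)]
              have h5 : Real.exp 3 = Real.exp 1 ^ 3 := by rw [← Real.exp_nat_mul]; norm_num
              have h6 := Real.exp_one_gt_d9
              rw [h5]
              calc (1 / 20 : ℝ)⁻¹ ≤ 2.718 ^ 3 := by norm_num
                _ ≤ _ := by gcongr; linarith
            linarith
    have h1 : Real.exp (-(3 * K * Real.log T)) * ‖G z‖ ≤ C * T ^ (2 : ℝ) := by
      refine le_trans ?_ hle
      rw [hzG z, norm_mul]
      gcongr
    have h2 : C * T ^ (2 : ℝ) ≤ Real.exp ((Real.log C - Real.log c₀ + 2) * Real.log T) * c₀ := by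
      calc C * T ^ (2 : ℝ) = Real.exp (Real.log C - Real.log c₀ + 2 * Real.log T) * c₀ := by
            rw [Real.exp_add, Real.exp_sub, Real.exp_log (by linarith), Real.exp_log hc0,
              Real.rpow_def_of_pos hT0, mul_comm (Real.log T)]
            field_simp
        _ ≤ _ := by gcongr; nlinarith
    have h3 : Real.exp (L * Real.log T) = Real.exp (3 * K * Real.log T) *
        Real.exp ((Real.log C - Real.log c₀ + 2) * Real.log T) := by
      rw [← Real.exp_add, hL]; congr 1; ring
    have h4 : ‖G z‖ = Real.exp (3 * K * Real.log T) * (Real.exp (-(3 * K * Real.log T)) * ‖G z‖) := by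
      rw [← mul_assoc, ← Real.exp_add]; simp
    calc ‖G z‖ = _ := h4
      _ ≤ Real.exp (3 * K * Real.log T) *
          (Real.exp ((Real.log C - Real.log c₀ + 2) * Real.log T) * ‖G c‖) := by
          gcongr Real.exp (3 * K * Real.log T) * ?_
          exact h1.trans (h2.trans (by gcongr))
      _ = _ := by rw [h3]; ring
  have hGb : ∀ z ∈ ball c (9 / 10), ‖G z‖ ≤ Real.exp (L * Real.log T) * ‖G c‖ := by
    intro z hz
    refine Complex.norm_le_of_forall_mem_frontier_norm_le (U := ball c (95 / 100)) isBounded_ball ?_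
      (fun w hw => hGs w (by rwa [frontier_ball c (by norm_num)] at hw))
      (subset_closure (ball_subset_ball (by norm_num) hz))
    have hd : DifferentiableOn ℂ G (closedBall c (95 / 100)) := fun w hw =>
      (hG w (hsub1 (closedBall_subset_closedBall (by norm_num) hw))).differentiableAt.differentiableWithinAt
    exact hd.diffContOnCl_ball subset_rfl
  have hlip := lipschitz_logDeriv_of_norm_le (M := L * Real.log T) (by positivity)
    (fun w hw => (hG w (hsub9 (ball_subset_closedBall hw))).differentiableAt.differentiableWithinAt)
    (fun w hw => hGne w (ball_subset_closedBall hw)) hGb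
  have hball : ball s₀ (1 / 2000) ⊆ ball c (6 / 10) := fun z hz => by
    rw [mem_ball, dist_eq_norm] at hz
    rw [mem_ball, dist_comm, dist_eq_norm]
    linarith [norm_rightCenter_sub_le hz.le]
  classical
  -- The other zeros stay at distance at least 1/2000 from the small disc, so their terms are
  -- Lipschitz there and can be put into the remainder.
  set near := fun a : ℂ => ‖a - s₀‖ ≤ 1 / 1000 with hnear
  refine ⟨Z₁.filter near, fun s => ∑ a ∈ Z₁.filter (fun a => ¬ near a), (m a : ℂ) * (1 / (s - a)) +
    logDeriv G s, ?_, ?_, ?_⟩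
  · intro a
    rw [Finset.mem_filter, hmemZ1, hnear]
    constructor
    · rintro ⟨⟨-, h⟩, h'⟩; exact ⟨h, h'⟩
    · rintro ⟨h, h'⟩
      refine ⟨⟨?_, h⟩, h'⟩
      rw [mem_closedBall, dist_comm, dist_eq_norm]
      linarith [norm_rightCenter_sub_le h']
  · intro s hs hzs
    have hs9 : s ∈ closedBall c (9 / 10) :=
      ball_subset_closedBall (ball_subset_ball (by norm_num) (hball hs))
    rw [← add_assoc, Finset.sum_filter_add_sum_filter_not, ← logDeriv_apply]
    have e : riemannZeta = fun z => (∏ a ∈ Z₁, (z - a) ^ m a) * G z := funext hzG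
    conv_lhs => rw [e]
    refine logDeriv_prod_sub_pow (fun a ha => ?_) (hG s (hsub9 hs9)).differentiableAt (hGne s hs9)
    rintro rfl
    exact hzs ((hmemZ1 s).1 ha).2
  · intro s hs w hw
    have hlipG := hlip s (hball hs) w (hball hw)
    rw [mem_ball, dist_eq_norm] at hs hw
    have hsum : ‖∑ a ∈ Z₁.filter (fun a => ¬ near a), (m a : ℂ) * (1 / (s - a)) -
        ∑ a ∈ Z₁.filter (fun a => ¬ near a), (m a : ℂ) * (1 / (w - a))‖ ≤
        K * Real.log T * (4000000 * ‖s - w‖) := by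
      rw [← Finset.sum_sub_distrib]
      calc _ ≤ ∑ a ∈ Z₁.filter (fun a => ¬ near a), (m a : ℝ) * (4000000 * ‖s - w‖) := by
            refine norm_sum_le_of_le _ fun a ha => ?_
            have hna := (Finset.mem_filter.1 ha).2
            simp only [hnear, not_le] at hna
            have hd : ∀ u : ℂ, ‖u - s₀‖ < 1 / 2000 → 1 / 2000 ≤ ‖u - a‖ := by
              intro u hu
              have : ‖a - s₀‖ ≤ ‖u - a‖ + ‖u - s₀‖ := by
                rw [norm_sub_rev u a]
                simpa using norm_add_le (a - u) (u - s₀)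
              linarith
            have h1 := hd s hs
            have h2 := hd w hw
            have h1' : s - a ≠ 0 := norm_pos_iff.1 (by linarith)
            have h2' : w - a ≠ 0 := norm_pos_iff.1 (by linarith)
            have e : (m a : ℂ) * (1 / (s - a)) - m a * (1 / (w - a)) =
                m a * ((w - s) / ((s - a) * (w - a))) := by field_simp; ring
            rw [e, norm_mul, Complex.norm_natCast, norm_div, norm_mul, norm_sub_rev w s]
            gcongr
            rw [div_le_iff₀ (by positivity)]
            have : (1 / 2000 : ℝ) * (1 / 2000) ≤ ‖s - a‖ * ‖w - a‖ := by gcongr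
            nlinarith [norm_nonneg (s - w)]
        _ ≤ _ := by
            rw [← Finset.sum_mul]
            gcongr
            refine (Finset.sum_le_sum_of_subset_of_nonneg (Finset.filter_subset _ _) fun _ _ _ => by positivity).trans hn
    rw [add_sub_add_comm]
    refine (norm_add_le _ _).trans ((add_le_add hsum hlipG).trans (le_of_eq ?_))
    ring

/-! ### Symmetry of the zeros about the critical line. -/

theorem analyticOrderAt_riemannZeta_eq_completed {a : ℂ} (h0 : 0 < a.re) (h1 : a ≠ 1) :
    analyticOrderAt riemannZeta a = analyticOrderAt completedRiemannZeta a := by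
  have ha0 : a ≠ 0 := by rintro rfl; simp at h0
  have hG : AnalyticAt ℂ (fun s => (Complex.Gammaℝ s)⁻¹) a :=
    Complex.differentiable_Gammaℝ_inv.analyticAt a
  have hL : AnalyticAt ℂ completedRiemannZeta a := by
    refine DifferentiableOn.analyticAt (s := {0}ᶜ ∩ {1}ᶜ) (fun s hs =>
      (differentiableAt_completedZeta hs.1 hs.2).differentiableWithinAt) ?_
    exact (isOpen_compl_singleton.inter isOpen_compl_singleton).mem_nhds ⟨ha0, h1⟩
  have e : riemannZeta =ᶠ[𝓝 a] completedRiemannZeta * fun s => (Complex.Gammaℝ s)⁻¹ := by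
    filter_upwards [isOpen_compl_singleton.mem_nhds (show a ∈ ({0} : Set ℂ)ᶜ from ha0)] with s hs
    rw [riemannZeta_def_of_ne_zero hs, Pi.mul_apply, div_eq_mul_inv]
  rw [analyticOrderAt_congr e, analyticOrderAt_mul hL hG,
    hG.analyticOrderAt_eq_zero.2 (inv_ne_zero (Complex.Gammaℝ_ne_zero_of_re_pos h0)), add_zero]

theorem analyticOrderAt_riemannZeta_one_sub {a : ℂ} (h0 : 0 < a.re) (h1 : a.re < 1) :
    analyticOrderAt riemannZeta (1 - a) = analyticOrderAt riemannZeta a := by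
  rw [analyticOrderAt_riemannZeta_eq_completed h0 (by rintro rfl; simp at h1),
    analyticOrderAt_riemannZeta_eq_completed (by simpa using h1) (by intro h; simp at h; simp [h] at h0)]
  have hd : deriv (fun s : ℂ => 1 - s) a ≠ 0 := by
    simp
  rw [← analyticOrderAt_comp_of_deriv_ne_zero (f := completedRiemannZeta) (g := fun s => 1 - s)
    (by fun_prop) hd]
  exact analyticOrderAt_congr (Eventually.of_forall fun s => completedRiemannZeta_one_sub s)

theorem analyticOrderNatAt_riemannZeta_conj {a : ℂ} (h1 : a ≠ 1) :
    analyticOrderNatAt riemannZeta (starRingEnd ℂ a) = analyticOrderNatAt riemannZeta a := by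
  have h1' : starRingEnd ℂ a ≠ 1 := fun h => h1 (by simpa using congrArg (starRingEnd ℂ) h)
  obtain ⟨g, hg, hga, he⟩ := (analyticOn_riemannZeta a h1).analyticOrderAt_ne_top.1
    (analyticOrderAt_riemannZeta_ne_top h1)
  refine ((analyticOn_riemannZeta _ h1').analyticOrderNatAt_eq_iff
    (analyticOrderAt_riemannZeta_ne_top h1')).2 ⟨starRingEnd ℂ ∘ g ∘ starRingEnd ℂ, ?_, by simpa using hga, ?_⟩
  · rw [Complex.analyticAt_iff_eventually_differentiableAt] at hg ⊢
    have hc := Complex.continuous_conj.tendsto (starRingEnd ℂ a)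
    rw [Complex.conj_conj] at hc
    filter_upwards [hc.eventually hg] with z hz
    exact differentiableAt_conj_conj_iff.2 hz
  · have hc := Complex.continuous_conj.tendsto (starRingEnd ℂ a)
    rw [Complex.conj_conj] at hc
    filter_upwards [hc.eventually he] with z hz
    have := congrArg (starRingEnd ℂ) hz
    rw [riemannZeta_conj, Complex.conj_conj] at this
    rw [this]
    simp

theorem analyticOrderNatAt_riemannZeta_reflect {a : ℂ} (h0 : 0 < a.re) (h1 : a.re < 1) :
    analyticOrderNatAt riemannZeta (1 - starRingEnd ℂ a) = analyticOrderNatAt riemannZeta a := by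
  rw [← analyticOrderNatAt_riemannZeta_conj (a := a) (by rintro rfl; simp at h1), analyticOrderNatAt,
    analyticOrderNatAt, analyticOrderAt_riemannZeta_one_sub (by simpa using h0) (by simpa using h1)]

theorem riemannZeta_reflect_eq_zero {a : ℂ} (h0 : 0 < a.re) (h1 : a.re < 1) (ha : riemannZeta a = 0) :
    riemannZeta (1 - starRingEnd ℂ a) = 0 := by
  have h := norm_riemannZeta_one_sub_conj h0 h1
  rw [ha, norm_zero, zero_mul, mul_eq_zero] at h
  refine norm_eq_zero.1 (h.resolve_right ?_)
  exact norm_ne_zero_iff.2 (Complex.Gammaℝ_ne_zero_of_re_pos (by simpa using h1))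

/-- The contribution of a zero `a` and its mirror image in the critical line. -/
theorem re_one_div_sub_add_reflect {s a : ℂ} (h1 : s ≠ a) (h2 : s ≠ 1 - starRingEnd ℂ a) :
    (1 / (s - a) + 1 / (s - (1 - starRingEnd ℂ a))).re =
      2 * (1 / 2 - s.re) * ((a.re - 1 / 2) ^ 2 - (1 / 2 - s.re) ^ 2 - (s.im - a.im) ^ 2) /
        (‖s - a‖ ^ 2 * ‖s - (1 - starRingEnd ℂ a)‖ ^ 2) := by
  have p1 : Complex.normSq (s - a) ≠ 0 := by rw [Ne, Complex.normSq_eq_zero]; exact sub_ne_zero.2 h1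
  have p2 : Complex.normSq (s - (1 - starRingEnd ℂ a)) ≠ 0 := by
    rw [Ne, Complex.normSq_eq_zero]; exact sub_ne_zero.2 h2
  rw [Complex.add_re, one_div, one_div, Complex.inv_re, Complex.inv_re, Complex.sq_norm, Complex.sq_norm,
    div_add_div _ _ p1 p2]
  congr 1
  simp only [Complex.normSq_apply, Complex.sub_re, Complex.sub_im, Complex.one_re, Complex.one_im,
    Complex.conj_re, Complex.conj_im]
  ring

/-- The hypothesis `ha` says that s is not inside the disc having a and its mirror image as
diameter; for a on the critical line it always holds. -/
theorem re_pair_nonpos {s a : ℂ} (h1 : s ≠ a) (h2 : s ≠ 1 - starRingEnd ℂ a) (hs : s.re ≤ 1 / 2)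
    (ha : (a.re - 1 / 2) ^ 2 ≤ (1 / 2 - s.re) ^ 2 + (s.im - a.im) ^ 2) :
    (1 / (s - a) + 1 / (s - (1 - starRingEnd ℂ a))).re ≤ 0 := by
  rw [re_one_div_sub_add_reflect h1 h2]
  refine div_nonpos_of_nonpos_of_nonneg (mul_nonpos_of_nonneg_of_nonpos ?_ ?_) (by positivity) <;> linarith

/-- The bound carries the factor 1/2 − Re s, so a well-separated pair becomes harmless close to the
line. -/
theorem re_pair_le {s a : ℂ} {d : ℝ} (hd : 0 < d) (h1 : d ≤ ‖s - a‖) (h2 : d ≤ ‖s - (1 - starRingEnd ℂ a)‖)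
    (hs : s.re ≤ 1 / 2) (ha : |a.re - 1 / 2| ≤ 2 * d) :
    (1 / (s - a) + 1 / (s - (1 - starRingEnd ℂ a))).re ≤ 8 * (1 / 2 - s.re) / d ^ 2 := by
  rw [re_one_div_sub_add_reflect (sub_ne_zero.1 (norm_pos_iff.1 (hd.trans_le h1)))
    (sub_ne_zero.1 (norm_pos_iff.1 (hd.trans_le h2)))]
  have hx : 0 ≤ 1 / 2 - s.re := by linarith
  have hb : (a.re - 1 / 2) ^ 2 ≤ (2 * d) ^ 2 := by rw [← sq_abs]; gcongr
  calc _ ≤ 2 * (1 / 2 - s.re) * (2 * d) ^ 2 / (d ^ 2 * d ^ 2) := by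
        gcongr
        nlinarith [sq_nonneg (1 / 2 - s.re), sq_nonneg (s.im - a.im)]
    _ = _ := by field_simp; ring

/-- `Z` is the set of zeros of `ζ` within `1/1000` of `1/2 + iT`. -/
structure IsLocalZeros (T : ℝ) (Z : Finset ℂ) : Prop where
  mem_iff : ∀ a, a ∈ Z ↔ riemannZeta a = 0 ∧ ‖a - (1 / 2 + Complex.I * T)‖ ≤ 1 / 1000

namespace IsLocalZeros
variable {T : ℝ} {Z : Finset ℂ}

theorem re_sub_abs_le (h : IsLocalZeros T Z) {a : ℂ} (ha : a ∈ Z) : |a.re - 1 / 2| ≤ 1 / 1000 := by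
  have := (Complex.abs_re_le_norm _).trans ((h.mem_iff a).1 ha).2
  simpa using this

theorem norm_reflect_sub (T : ℝ) (a : ℂ) : ‖1 - starRingEnd ℂ a - (1 / 2 + Complex.I * T)‖ =
    ‖a - (1 / 2 + Complex.I * T)‖ := by
  have : 1 - starRingEnd ℂ a - (1 / 2 + Complex.I * T) =
      -starRingEnd ℂ (a - (1 / 2 + Complex.I * T)) := by
    apply Complex.ext
    · simp; ring
    · simp; ring
  rw [this, norm_neg, RCLike.norm_conj]

theorem reflect_mem (h : IsLocalZeros T Z) {a : ℂ} (ha : a ∈ Z) : 1 - starRingEnd ℂ a ∈ Z := by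
  obtain ⟨h1, h2⟩ := abs_le.1 (h.re_sub_abs_le ha)
  obtain ⟨h3, h4⟩ := (h.mem_iff a).1 ha
  exact (h.mem_iff _).2 ⟨riemannZeta_reflect_eq_zero (by linarith) (by linarith) h3,
    (norm_reflect_sub T a).trans_le h4⟩

theorem order_reflect (h : IsLocalZeros T Z) {a : ℂ} (ha : a ∈ Z) :
    analyticOrderNatAt riemannZeta (1 - starRingEnd ℂ a) = analyticOrderNatAt riemannZeta a := by
  obtain ⟨h1, h2⟩ := abs_le.1 (h.re_sub_abs_le ha)
  exact analyticOrderNatAt_riemannZeta_reflect (by linarith) (by linarith)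

/-- Reflection permutes the zeros and keeps multiplicities, so the sum may be added to its reflected
copy. -/
theorem two_mul_re_sum (h : IsLocalZeros T Z) (s : ℂ) :
    2 * (∑ a ∈ Z, (analyticOrderNatAt riemannZeta a : ℂ) * (1 / (s - a))).re =
      ∑ a ∈ Z, (analyticOrderNatAt riemannZeta a : ℝ) *
        (1 / (s - a) + 1 / (s - (1 - starRingEnd ℂ a))).re := by
  have e : ∑ a ∈ Z, (analyticOrderNatAt riemannZeta a : ℂ) * (1 / (s - a)) =
      ∑ a ∈ Z, (analyticOrderNatAt riemannZeta a : ℂ) * (1 / (s - (1 - starRingEnd ℂ a))) := by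
    refine Finset.sum_nbij' (fun a => 1 - starRingEnd ℂ a) (fun a => 1 - starRingEnd ℂ a)
      (fun a ha => h.reflect_mem ha) (fun a ha => h.reflect_mem ha) (fun a _ => by simp)
      (fun a _ => by simp) fun a ha => ?_
    rw [h.order_reflect ha]; simp
  rw [two_mul]
  nth_rewrite 2 [e]
  rw [← Complex.add_re, ← Finset.sum_add_distrib, Complex.re_sum]
  refine Finset.sum_congr rfl fun a _ => ?_
  rw [← mul_add, ← Complex.re_ofReal_mul]
  simp

theorem re_sum_le (h : IsLocalZeros T Z) {s : ℂ} {B : ℝ}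
    (hB : ∀ a ∈ Z, (1 / (s - a) + 1 / (s - (1 - starRingEnd ℂ a))).re ≤ 2 * B) :
    (∑ a ∈ Z, (analyticOrderNatAt riemannZeta a : ℂ) * (1 / (s - a))).re ≤
      B * ∑ a ∈ Z, (analyticOrderNatAt riemannZeta a : ℝ) := by
  have h1 := h.two_mul_re_sum s
  have h2 : ∑ a ∈ Z, (analyticOrderNatAt riemannZeta a : ℝ) *
        (1 / (s - a) + 1 / (s - (1 - starRingEnd ℂ a))).re ≤
      ∑ a ∈ Z, (analyticOrderNatAt riemannZeta a : ℝ) * (2 * B) := by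
    refine Finset.sum_le_sum fun a ha => ?_
    gcongr
    exact hB a ha
  rw [← Finset.sum_mul] at h2
  linarith

theorem re_sum_eq_zero (h : IsLocalZeros T Z) {s : ℂ} (hs : s.re = 1 / 2) (hsZ : s ∉ Z) :
    (∑ a ∈ Z, (analyticOrderNatAt riemannZeta a : ℂ) * (1 / (s - a))).re = 0 := by
  have h1 := h.two_mul_re_sum s
  rw [Finset.sum_eq_zero (s := Z) (f := fun a => (analyticOrderNatAt riemannZeta a : ℝ) *
    (1 / (s - a) + 1 / (s - (1 - starRingEnd ℂ a))).re)] at h1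
  · linarith
  · intro a ha
    rw [re_one_div_sub_add_reflect (by rintro rfl; exact hsZ ha)
      (by rintro rfl; exact hsZ (h.reflect_mem ha)), hs]
    simp

theorem one_le_order (h : IsLocalZeros T Z) {a : ℂ} (ha : a ∈ Z) :
    (1 : ℝ) ≤ analyticOrderNatAt riemannZeta a := by
  have h0 := ((h.mem_iff a).1 ha).1
  have ha1 : a ≠ 1 := by
    rintro rfl
    have := h.re_sub_abs_le ha
    norm_num at this
  have : analyticOrderNatAt riemannZeta a ≠ 0 := by
    intro hz
    have h2 := Nat.cast_analyticOrderNatAt (analyticOrderAt_riemannZeta_ne_top ha1)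
    rw [hz] at h2
    exact ((analyticOn_riemannZeta a ha1).analyticOrderAt_eq_zero.1 h2.symm) h0
  exact_mod_cast Nat.one_le_iff_ne_zero.2 this

/-- Off-line zeros come in mirror pairs. -/
theorem two_mul_card_left_le (h : IsLocalZeros T Z) :
    2 * ((Z.filter fun a => a.re < 1 / 2).card : ℝ) ≤ ∑ a ∈ Z, (analyticOrderNatAt riemannZeta a : ℝ) := by
  have hcard : (Z.filter fun a => a.re < 1 / 2).card ≤ (Z.filter fun a => ¬ a.re < 1 / 2).card := by
    refine Finset.card_le_card_of_injOn (fun a => 1 - starRingEnd ℂ a) (fun a ha => ?_) (fun a _ b _ hab => ?_)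
    · have ha' := Finset.mem_filter.1 ha
      refine Finset.mem_filter.2 ⟨h.reflect_mem ha'.1, ?_⟩
      simp only [Complex.sub_re, Complex.one_re, Complex.conj_re, not_lt]
      linarith [ha'.2]
    · have h1 : starRingEnd ℂ a = starRingEnd ℂ b := by simpa using hab
      exact (starRingEnd ℂ).injective h1
  have h3 := Finset.card_filter_add_card_filter_not (s := Z) (fun a : ℂ => a.re < 1 / 2)
  have h4 : (Z.card : ℝ) ≤ ∑ a ∈ Z, (analyticOrderNatAt riemannZeta a : ℝ) := by
    rw [Finset.card_eq_sum_ones]; push_cast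
    exact Finset.sum_le_sum fun a ha => h.one_le_order ha
  have h5 : 2 * ((Z.filter fun a => a.re < 1 / 2).card : ℝ) ≤ (Z.card : ℝ) := by
    exact_mod_cast (by lia : 2 * (Z.filter fun a => a.re < 1 / 2).card ≤ Z.card)
  linarith

end IsLocalZeros

/-! ### Scales that avoid the off-line zeros. -/

/-- A pigeonhole principle on a doubling scale: a set of `N` reals misses one of the intervals
`[L / 2 - B, L + B]` for some `L` between `L₀` and `2 ^ N * (L₀ + 5 * B)`. -/
theorem exists_scale_avoiding (S : Finset ℝ) {B L₀ : ℝ} (hB : 0 < B) (hL : 0 ≤ L₀) :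
    ∃ L : ℝ, L₀ ≤ L ∧ L ≤ 2 ^ S.card * (L₀ + 5 * B) ∧ ∀ x ∈ S, x < L / 2 - B ∨ L + B < x := by
  -- The solution of l(k + 1) = 2 l(k) + 5B with l(0) = L₀. The intervals [l(k)/2 − B, l(k) + B] are
  -- then disjoint, as l(k + 1)/2 − B = l(k) + 3B/2, and one more of them than there are points
  -- suffices.
  set l : ℕ → ℝ := fun k => 2 ^ k * (L₀ + 5 * B) - 5 * B with hl
  have hstep : ∀ k, l (k + 1) = 2 * l k + 5 * B := fun k => by simp only [hl]; ring
  have hmono : Monotone l := by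
    intro i j hij
    simp only [hl]
    have : (2 : ℝ) ^ i ≤ 2 ^ j := pow_le_pow_right₀ (by norm_num) hij
    nlinarith
  have hdisj : ∀ i j, i < j → l i + B < l j / 2 - B := by
    intro i j hij
    have h1 := hmono (Nat.succ_le_of_lt hij)
    rw [Nat.succ_eq_add_one, hstep] at h1
    linarith
  by_contra hcon
  push Not at hcon
  have hex : ∀ k ∈ Finset.range (S.card + 1), ∃ x ∈ S, l k / 2 - B ≤ x ∧ x ≤ l k + B := by
    intro k hk
    have hk' : k ≤ S.card := Nat.lt_succ_iff.1 (Finset.mem_range.1 hk)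
    refine hcon (l k) ?_ ?_
    · have := hmono (Nat.zero_le k)
      simp only [hl, pow_zero] at this ⊢
      linarith
    · have := hmono hk'
      simp only [hl] at this ⊢
      linarith
  choose! f hfS hf1 hf2 using hex
  have hinj : Set.InjOn f (Finset.range (S.card + 1)) := by
    intro i hi j hj hij
    by_contra hne
    rcases lt_or_gt_of_ne hne with h | h
    · have := hdisj i j h
      linarith [hf2 i hi, hf1 j hj]
    · have := hdisj j i h
      linarith [hf2 j hj, hf1 i hi]
  have := Finset.card_le_card_of_injOn f (fun k hk => hfS k hk) hinj
  simp at this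

/-! ### Sign of Re (ζ'/ζ) to the left of the critical line. -/

/-- The local expansion of `ζ' / ζ` at `1/2 + iT`, with remainder of negative real part on the
critical line. -/
structure IsLocalExpansion (T K : ℝ) (Z : Finset ℂ) (Q : ℂ → ℂ) : Prop extends IsLocalZeros T Z where
  logDeriv_eq : ∀ s ∈ ball (1 / 2 + Complex.I * T) (1 / 2000), riemannZeta s ≠ 0 →
    deriv riemannZeta s / riemannZeta s =
      ∑ a ∈ Z, (analyticOrderNatAt riemannZeta a : ℂ) * (1 / (s - a)) + Q s
  lipschitz : ∀ s ∈ ball (1 / 2 + Complex.I * T) (1 / 2000),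
    ∀ w ∈ ball (1 / 2 + Complex.I * T) (1 / 2000), ‖Q s - Q w‖ ≤ K * ‖s - w‖
  re_le : ∀ t : ℝ, |t - T| < 1 / 2000 → (Q (1 / 2 + t * Complex.I)).re ≤ -1

theorem line_mem_ball {t T : ℝ} (ht : |t - T| < 1 / 2000) :
    (1 / 2 + t * Complex.I : ℂ) ∈ ball (1 / 2 + Complex.I * T) (1 / 2000) := by
  rw [mem_ball, dist_eq_norm]
  have : (1 / 2 + t * Complex.I : ℂ) - (1 / 2 + Complex.I * T) = ((t - T : ℝ) : ℂ) * Complex.I := by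
    push_cast; ring
  rw [this, norm_mul, Complex.norm_I, mul_one, Complex.norm_real]
  exact ht

theorem exists_isLocalExpansion :
    ∃ K T₀ : ℝ, 0 ≤ K ∧ 3 ≤ T₀ ∧ ∀ T : ℝ, T₀ ≤ T → ∃ Z : Finset ℂ, ∃ Q : ℂ → ℂ,
      IsLocalExpansion T (K * Real.log T) Z Q ∧
      ∑ a ∈ Z, (analyticOrderNatAt riemannZeta a : ℝ) ≤ 47 / 100 * Real.log T := by
  obtain ⟨K, hK0, hK⟩ := exists_logDeriv_riemannZeta_eq
  obtain ⟨T₁, hT1, hnear⟩ := exists_sum_order_le_near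
  obtain ⟨t₀, ht0, hline⟩ := exists_re_logDeriv_riemannZeta_le
  refine ⟨K, T₁ + t₀ + 3, hK0, by linarith, fun T hT => ?_⟩
  obtain ⟨Z, Q, hZ, hQ, hLip⟩ := hK T (by linarith)
  have hloc : IsLocalZeros T Z := ⟨hZ⟩
  have hℓ : 0 ≤ Real.log T := Real.log_nonneg (by linarith)
  refine ⟨Z, Q, ⟨hloc, hQ, hLip, fun t ht => ?_⟩, hnear T (by linarith) Z fun a ha => (hZ a).1 ha⟩
  have hne : ∀ u : ℝ, |u - T| < 1 / 2000 → riemannZeta (1 / 2 + u * Complex.I) ≠ 0 →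
      (Q (1 / 2 + u * Complex.I)).re ≤ -1 := by
    intro u hu hz
    have h1 := hline u (by linarith [(abs_lt.1 hu).1]) hz
    rw [hQ _ (line_mem_ball hu) hz, Complex.add_re, hloc.re_sum_eq_zero (by simp)
      (fun h => hz ((hZ _).1 h).1), zero_add] at h1
    exact h1
  -- At a zero of ζ on the line the bound for Re (ζ'/ζ) says nothing. But if Re Q > −1 at t, the
  -- Lipschitz bound keeps it so just above t, where all but finitely many points are not zeros.
  by_contra hcon
  push Not at hcon
  set M := K * Real.log T with hM
  have hM0 : 0 ≤ M := by positivity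
  set e := (Q (1 / 2 + t * Complex.I)).re + 1 with he
  have he0 : 0 < e := by linarith
  obtain ⟨b, htb, hbT⟩ : ∃ b, t < b ∧ b < min (T + 1 / 2000) (t + e / (M + 1)) := by
    apply exists_between
    refine lt_min (by linarith [(abs_lt.1 ht).2]) ?_
    have : 0 < e / (M + 1) := by positivity
    linarith
  have hfin : ((fun u : ℝ => (1 / 2 + u * Complex.I : ℂ)) ⁻¹' (Z : Set ℂ)).Finite := by
    refine Set.Finite.preimage (fun u _ v _ huv => ?_) Z.finite_toSet
    have := congrArg Complex.im huv
    simpa using this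
  obtain ⟨u, ⟨hu1, hu2⟩, huZ⟩ := ((Ioo_infinite htb).sdiff hfin).nonempty
  have huT : |u - T| < 1 / 2000 := by
    have h1 := (abs_lt.1 ht).1
    have h2 := hbT.trans_le (min_le_left _ _)
    rw [abs_lt]; constructor <;> linarith
  have hzu : riemannZeta (1 / 2 + u * Complex.I) ≠ 0 := by
    intro h0
    apply huZ
    refine (hZ _).2 ⟨h0, ?_⟩
    have := line_mem_ball huT
    rw [mem_ball, dist_eq_norm] at this
    linarith
  have h1 := hne u huT hzu
  have h2 := hLip _ (line_mem_ball ht) _ (line_mem_ball huT)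
  have h3 := (Complex.re_le_norm (Q (1 / 2 + t * Complex.I) - Q (1 / 2 + u * Complex.I))).trans h2
  have h4 : ‖(1 / 2 + t * Complex.I : ℂ) - (1 / 2 + u * Complex.I)‖ = u - t := by
    have : (1 / 2 + t * Complex.I : ℂ) - (1 / 2 + u * Complex.I) = ((t - u : ℝ) : ℂ) * Complex.I := by
      push_cast; ring
    rw [this, norm_mul, Complex.norm_I, mul_one, Complex.norm_real, Real.norm_eq_abs, abs_sub_comm,
      abs_of_pos (by linarith)]
  rw [h4, Complex.sub_re] at h3
  have h5 := hbT.trans_le (min_le_right _ _)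
  have h6 : (u - t) * (M + 1) < e := by
    rw [← lt_div_iff₀ (by positivity)]; linarith
  nlinarith

namespace IsLocalExpansion
variable {T K : ℝ} {Z : Finset ℂ} {Q : ℂ → ℂ}

/-- The remainder at s is compared with its value at the horizontal projection of s to the critical
line. -/
theorem re_logDeriv_le (h : IsLocalExpansion T K Z Q) {s : ℂ}
    (hs : s ∈ ball (1 / 2 + Complex.I * T) (1 / 2000)) (hsre : s.re ≤ 1 / 2) (hz : riemannZeta s ≠ 0)
    {B : ℝ} (hB : ∀ a ∈ Z, (1 / (s - a) + 1 / (s - (1 - starRingEnd ℂ a))).re ≤ 2 * B) :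
    (deriv riemannZeta s / riemannZeta s).re ≤
      -1 + K * (1 / 2 - s.re) + B * ∑ a ∈ Z, (analyticOrderNatAt riemannZeta a : ℝ) := by
  have him : |s.im - T| < 1 / 2000 := by
    rw [mem_ball, dist_eq_norm] at hs
    have := (Complex.abs_im_le_norm _).trans_lt hs
    simpa using this
  have h1 := h.lipschitz s hs _ (line_mem_ball him)
  have h2 : ‖s - (1 / 2 + s.im * Complex.I)‖ = 1 / 2 - s.re := by
    have : s - (1 / 2 + s.im * Complex.I) = ((s.re - 1 / 2 : ℝ) : ℂ) := by
      apply Complex.ext <;> simp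
    rw [this, Complex.norm_real, Real.norm_eq_abs, abs_sub_comm, abs_of_nonneg (by linarith)]
  rw [h2] at h1
  have h3 := (Complex.re_le_norm _).trans h1
  rw [Complex.sub_re] at h3
  have h4 := h.re_le s.im him
  have h5 := h.toIsLocalZeros.re_sum_le hB
  rw [h.logDeriv_eq s hs hz, Complex.add_re]
  linarith

theorem abs_re_sub_le_norm (T : ℝ) (a : ℂ) : |a.re - 1 / 2| ≤ ‖a - (1 / 2 + Complex.I * T)‖ := by
  simpa using Complex.abs_re_le_norm (a - (1 / 2 + Complex.I * T))

/-- `Re (ζ' / ζ) < 0` to the left of the critical line, on an annulus that is well separated from the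
zeros off the line. -/
theorem re_logDeriv_neg_of_annulus (h : IsLocalExpansion T K Z Q) (hK : 0 ≤ K) {r D n : ℝ} (hr : 0 < r)
    (hr1 : 3 * r < 1 / 2000) (hD : 6 * r ≤ D)
    (hgap : ∀ a ∈ Z, a.re ≠ 1 / 2 → ‖a - (1 / 2 + Complex.I * T)‖ < r / 3 ∨
      D < ‖a - (1 / 2 + Complex.I * T)‖)
    (hn : ∑ a ∈ Z, (analyticOrderNatAt riemannZeta a : ℝ) ≤ n)
    (hKr : K * (3 * r) ≤ 1 / 4) (hDr : 48 * r / D ^ 2 * n ≤ 1 / 4) {s : ℂ} (hsre : s.re < 1 / 2)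
    (hs1 : r ≤ ‖s - (1 / 2 + Complex.I * T)‖) (hs2 : ‖s - (1 / 2 + Complex.I * T)‖ ≤ 3 * r) :
    (deriv riemannZeta s / riemannZeta s).re < 0 := by
  set s₀ : ℂ := 1 / 2 + Complex.I * T with hs0
  have hx : 1 / 2 - s.re ≤ 3 * r := by
    have := (neg_le_abs _).trans ((abs_re_sub_le_norm T s).trans hs2)
    linarith
  have hsZ : s ∉ Z := by
    intro hsZ
    rcases hgap s hsZ hsre.ne with h | h <;> linarith
  have hz : riemannZeta s ≠ 0 := fun h0 => hsZ ((h.mem_iff s).2 ⟨h0, by linarith⟩)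
  have hD0 : 0 < D := by linarith
  have hpair : ∀ a ∈ Z, (1 / (s - a) + 1 / (s - (1 - starRingEnd ℂ a))).re ≤ 2 * (48 * r / D ^ 2) := by
    intro a ha
    have hne1 : s ≠ a := by rintro rfl; exact hsZ ha
    have hne2 : s ≠ 1 - starRingEnd ℂ a := fun heq => hsZ (heq ▸ h.reflect_mem ha)
    by_cases hare : a.re = 1 / 2
    · refine (re_pair_nonpos hne1 hne2 hsre.le ?_).trans (by positivity)
      rw [hare]; nlinarith [sq_nonneg (1 / 2 - s.re), sq_nonneg (s.im - a.im)]
    rcases hgap a ha hare with hsmall | hbig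
    · refine (re_pair_nonpos hne1 hne2 hsre.le ?_).trans (by positivity)
      have h1 := (abs_re_sub_le_norm T a).trans hsmall.le
      have h2 : |a.im - T| ≤ r / 3 := by
        have := (Complex.abs_im_le_norm (a - s₀)).trans hsmall.le
        simpa [hs0] using this
      have h3 : ‖s - s₀‖ ^ 2 = (1 / 2 - s.re) ^ 2 + (s.im - T) ^ 2 := by
        rw [Complex.sq_norm, Complex.normSq_apply]; simp [hs0]; ring
      have h4 : r ^ 2 ≤ (1 / 2 - s.re) ^ 2 + (s.im - T) ^ 2 := by rw [← h3]; gcongr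
      have h5 : (a.re - 1 / 2) ^ 2 ≤ (r / 3) ^ 2 := by rw [← sq_abs]; gcongr
      have h6 : (a.im - T) ^ 2 ≤ (r / 3) ^ 2 := by rw [← sq_abs]; gcongr
      nlinarith [sq_nonneg (3 * (a.im - T) - (s.im - T)), sq_nonneg ((s.im - T) - 2 * (a.im - T)),
        sq_nonneg (1 / 2 - s.re), sq_nonneg (s.im - T)]
    -- Since |s − s₀| ≤ 3r ≤ D/2, both a and its mirror image are at distance at least |a − s₀|/2 >
    -- D/2 from s.
    · have hd1 : D / 2 ≤ ‖a - s₀‖ - ‖s - s₀‖ := by linarith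
      have hbig' : ‖1 - starRingEnd ℂ a - s₀‖ = ‖a - s₀‖ := IsLocalZeros.norm_reflect_sub T a
      have tri : ∀ b : ℂ, ‖b - s₀‖ - ‖s - s₀‖ ≤ ‖s - b‖ := fun b => by
        have := norm_sub_norm_le (b - s₀) (s - s₀)
        rw [norm_sub_rev s b]; simpa using this
      have hd0 : 0 < ‖a - s₀‖ / 2 := by linarith
      refine (re_pair_le (d := ‖a - s₀‖ / 2) hd0 (by have := tri a; linarith)
        (by have := tri (1 - starRingEnd ℂ a); linarith) hsre.le ?_).trans ?_
      · have := abs_re_sub_le_norm T a; linarith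
      · calc 8 * (1 / 2 - s.re) / (‖a - s₀‖ / 2) ^ 2 ≤ 8 * (3 * r) / (D / 2) ^ 2 := by gcongr
          _ = _ := by field_simp; ring
  have hfin := h.re_logDeriv_le (by rw [mem_ball, dist_eq_norm]; linarith) hsre.le hz hpair
  have e1 : K * (1 / 2 - s.re) ≤ K * (3 * r) := by gcongr
  have e2 : 48 * r / D ^ 2 * ∑ a ∈ Z, (analyticOrderNatAt riemannZeta a : ℝ) ≤ 48 * r / D ^ 2 * n := by
    gcongr
  linarith

/-- `Re (ζ' / ζ) < 0` immediately to the left of the critical line. -/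
theorem eventually_re_logDeriv_neg (h : IsLocalExpansion T K Z Q) {ρ : ℝ} (hρ : ρ < 1 / 2000) :
    ∀ᶠ ε : ℝ in 𝓝[>] 0, ∀ t : ℝ, |t - T| ≤ ρ →
      (deriv riemannZeta (1 / 2 - ε + t * Complex.I) / riemannZeta (1 / 2 - ε + t * Complex.I)).re < 0 := by
  set n := ∑ a ∈ Z, (analyticOrderNatAt riemannZeta a : ℝ) with hn
  have hsmall : ∀ c δ : ℝ, 0 < δ → ∀ᶠ ε in 𝓝[>] (0 : ℝ), c * ε < δ := by
    intro c δ hδ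
    have : Tendsto (fun ε : ℝ => c * ε) (𝓝[>] 0) (𝓝 (c * 0)) :=
      (Continuous.tendsto (by fun_prop) 0).mono_left nhdsWithin_le_nhds
    rw [mul_zero] at this
    exact this.eventually_lt_const hδ
  -- The smallness of ε may depend on the zeros. With β the distance of a from the line, 2ε < β
  -- separates s from the pair, and 64nε < β² makes the whole sum at most 1/4.
  have hZ : ∀ᶠ ε in 𝓝[>] (0 : ℝ), ∀ a ∈ Z, a.re ≠ 1 / 2 →
      2 * ε < |a.re - 1 / 2| ∧ 64 * n * ε < |a.re - 1 / 2| ^ 2 := by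
    rw [Filter.eventually_all_finset]
    intro a _
    by_cases ha : a.re = 1 / 2
    · exact Eventually.of_forall fun _ h => absurd ha h
    · have hp : 0 < |a.re - 1 / 2| := abs_pos.2 (sub_ne_zero.2 ha)
      filter_upwards [hsmall 2 _ hp, hsmall (64 * n) _ (pow_pos hp 2)] with ε h1 h2 _
      exact ⟨h1, h2⟩
  filter_upwards [hZ, hsmall K (1 / 4) (by norm_num), hsmall 1 (1 / 2000 - ρ) (by linarith),
    self_mem_nhdsWithin] with ε hε1 hε2 hε3 hε0 t ht
  simp only [mem_Ioi] at hε0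
  set s : ℂ := 1 / 2 - ε + t * Complex.I with hs
  have hsre : s.re = 1 / 2 - ε := by simp [hs]
  have hsim : s.im = t := by simp [hs]
  have hsb : ‖s - (1 / 2 + Complex.I * T)‖ < 1 / 2000 := by
    refine (Complex.norm_le_abs_re_add_abs_im _).trans_lt ?_
    simp only [Complex.sub_re, Complex.sub_im, hsre, hsim]
    have e1 : (1 / 2 + Complex.I * (T : ℂ)).re = 1 / 2 := by simp
    have e2 : (1 / 2 + Complex.I * (T : ℂ)).im = T := by simp
    rw [e1, e2, show 1 / 2 - ε - 1 / 2 = -ε by ring, abs_neg, abs_of_pos hε0]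
    linarith
  have hsZ : s ∉ Z := by
    intro hmem
    have hne : s.re ≠ 1 / 2 := by rw [hsre]; linarith
    have := (hε1 s hmem hne).1
    rw [hsre, show 1 / 2 - ε - 1 / 2 = -ε by ring, abs_neg, abs_of_pos hε0] at this
    linarith
  have hz : riemannZeta s ≠ 0 := fun h0 => hsZ ((h.mem_iff s).2 ⟨h0, by linarith⟩)
  have hn0 : 0 ≤ n := Finset.sum_nonneg fun _ _ => by positivity
  have hpair : ∀ a ∈ Z, (1 / (s - a) + 1 / (s - (1 - starRingEnd ℂ a))).re ≤ 2 * (1 / (4 * n)) := by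
    intro a ha
    have hne1 : s ≠ a := by rintro rfl; exact hsZ ha
    have hne2 : s ≠ 1 - starRingEnd ℂ a := fun heq => hsZ (heq ▸ h.reflect_mem ha)
    by_cases hare : a.re = 1 / 2
    · refine (re_pair_nonpos hne1 hne2 (by rw [hsre]; linarith) ?_).trans (by positivity)
      rw [hare]; nlinarith [sq_nonneg (1 / 2 - s.re), sq_nonneg (s.im - a.im)]
    obtain ⟨h1, h2⟩ := hε1 a ha hare
    set β := |a.re - 1 / 2| with hβ
    have hβ0 : 0 < β := abs_pos.2 (sub_ne_zero.2 hare)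
    have d1 : β / 2 ≤ ‖s - a‖ := by
      have g1 := Complex.abs_re_le_norm (s - a)
      rw [Complex.sub_re, hsre] at g1
      have g2 : β ≤ |1 / 2 - ε - a.re| + ε := by
        rw [hβ]
        calc |a.re - 1 / 2| = |(1 / 2 - ε - a.re) + ε| := by rw [abs_sub_comm]; congr 1; ring
          _ ≤ _ := (abs_add_le _ _).trans (by rw [abs_of_pos hε0])
      linarith
    have d2 : β / 2 ≤ ‖s - (1 - starRingEnd ℂ a)‖ := by
      have g1 := Complex.abs_re_le_norm (s - (1 - starRingEnd ℂ a))
      simp only [Complex.sub_re, Complex.one_re, Complex.conj_re, hsre] at g1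
      have g2 : β ≤ |1 / 2 - ε - (1 - a.re)| + ε := by
        rw [hβ]
        calc |a.re - 1 / 2| = |(1 / 2 - ε - (1 - a.re)) + ε| := by congr 1; ring
          _ ≤ _ := (abs_add_le _ _).trans (by rw [abs_of_pos hε0])
      linarith
    refine (re_pair_le (d := β / 2) (by positivity) d1 d2 (by rw [hsre]; linarith) (by linarith)).trans ?_
    rw [hsre]
    have hnpos : 0 < n := by
      have ha1 : (analyticOrderNatAt riemannZeta a : ℝ) ≤ n :=
        Finset.single_le_sum (f := fun a => (analyticOrderNatAt riemannZeta a : ℝ))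
          (fun _ _ => by positivity) ha
      by_contra hcon
      have hn00 : n = 0 := le_antisymm (not_lt.1 hcon) hn0
      have := h.toIsLocalZeros.one_le_order ha
      linarith
    rw [show (1 / 2 - (1 / 2 - ε)) = ε by ring, div_le_iff₀ (by positivity)]
    have e : 2 * (1 / (4 * n)) * (β / 2) ^ 2 = β ^ 2 / (8 * n) := by field_simp; ring
    rw [e, le_div_iff₀ (by positivity)]
    nlinarith
  have hfin := h.re_logDeriv_le (by rw [mem_ball, dist_eq_norm]; exact hsb) (by rw [hsre]; linarith) hz hpair
  rw [hsre] at hfin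
  have e3 : 1 / (4 * n) * n ≤ 1 / 4 := by
    rcases hn0.eq_or_lt with h0 | h0
    · rw [← h0]; norm_num
    · field_simp; norm_num
  have e4 : K * (1 / 2 - (1 / 2 - ε)) = K * ε := by ring
  rw [e4, ← hn] at hfin
  linarith

end IsLocalExpansion

/-! ### From the rectangle to the half-disc. -/

/-- If `Re (ζ' / ζ) < 0` on the left half of an annulus about `1/2 + iT` and immediately to the left
of the critical line, then `ζ` and `ζ'` have equally many zeros in the left half-disc. -/
theorem zeroCount_leftHalfDisc_eq {T r : ℝ} (hr : 0 < r) (hrT : 2 * r < T)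
    (hann : ∀ s : ℂ, s.re < 1 / 2 → r ≤ ‖s - (1 / 2 + Complex.I * T)‖ →
      ‖s - (1 / 2 + Complex.I * T)‖ ≤ 3 * r → (deriv riemannZeta s / riemannZeta s).re < 0)
    (hline : ∀ᶠ ε : ℝ in 𝓝[>] 0, ∀ t : ℝ, |t - T| ≤ 2 * r →
      (deriv riemannZeta (1 / 2 - ε + t * Complex.I) / riemannZeta (1 / 2 - ε + t * Complex.I)).re < 0) :
    (zerosIn riemannZeta (leftHalfDisc T r)).Finite ∧
      (zerosIn (deriv riemannZeta) (leftHalfDisc T r)).Finite ∧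
      zeroCount riemannZeta (leftHalfDisc T r) = zeroCount (deriv riemannZeta) (leftHalfDisc T r) := by
  set s₀ : ℂ := 1 / 2 + Complex.I * T with hs0
  have hs0re : s₀.re = 1 / 2 := by simp [hs0]
  have hs0im : s₀.im = T := by simp [hs0]
  have hζ : AnalyticOnNhd ℂ riemannZeta {1}ᶜ := analyticOn_riemannZeta
  have hζ' : AnalyticOnNhd ℂ (deriv riemannZeta) {1}ᶜ := hζ.deriv
  have hζfin : ∀ z ∈ ({1}ᶜ : Set ℂ), analyticOrderAt riemannZeta z ≠ ⊤ :=
    fun z hz => analyticOrderAt_riemannZeta_ne_top hz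
  have hne1 : ∀ z : ℂ, ‖z - s₀‖ ≤ 2 * r → z ∈ ({1}ᶜ : Set ℂ) := by
    rintro z hz rfl
    have := (Complex.abs_im_le_norm (1 - s₀)).trans hz
    rw [Complex.sub_im, hs0im, Complex.one_im, zero_sub, abs_neg] at this
    linarith [le_abs_self T]
  -- The point s₀ − 2r of the annulus witnesses that ζ' is not identically zero.
  have hζ'fin : ∀ z ∈ ({1}ᶜ : Set ℂ), analyticOrderAt (deriv riemannZeta) z ≠ ⊤ := by
    intro z hz
    have hp : ‖s₀ - (2 * r : ℝ) - s₀‖ = 2 * r := by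
      rw [sub_right_comm, sub_self, zero_sub, norm_neg, Complex.norm_real, Real.norm_eq_abs,
        abs_of_pos (by positivity)]
    have hneg := hann (s₀ - (2 * r : ℝ)) (by rw [Complex.sub_re, hs0re, Complex.ofReal_re]; linarith)
      (by rw [hp]; linarith) (by rw [hp]; linarith)
    refine hζ'.analyticOrderAt_ne_top_of_isPreconnected (x := s₀ - (2 * r : ℝ))
      (isConnected_compl_singleton_of_one_lt_rank (by simp) 1).isPreconnected (hne1 _ hp.le) hz ?_
    rw [(hζ' _ (hne1 _ hp.le)).analyticOrderAt_eq_zero.2 (fun h0 => by rw [h0, zero_div] at hneg; simp at hneg)]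
    simp
  have hsub : leftHalfDisc T r ⊆ closedBall s₀ r := fun s hs => by
    rw [mem_closedBall, dist_eq_norm]; exact hs.1
  have hcb : closedBall s₀ r ⊆ {1}ᶜ := fun s hs => hne1 s (by
    rw [mem_closedBall, dist_eq_norm] at hs; linarith)
  have hfin1 : (zerosIn riemannZeta (leftHalfDisc T r)).Finite :=
    (finite_zeros_of_isCompact hζ hζfin (isCompact_closedBall s₀ r) hcb).subset
      fun s hs => ⟨hsub hs.1, hs.2⟩
  have hfin2 : (zerosIn (deriv riemannZeta) (leftHalfDisc T r)).Finite :=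
    (finite_zeros_of_isCompact hζ' hζ'fin (isCompact_closedBall s₀ r) hcb).subset
      fun s hs => ⟨hsub hs.1, hs.2⟩
  refine ⟨hfin1, hfin2, ?_⟩
  -- The finitely many zeros in the half-disc lie strictly left of the line, so a thin strip along
  -- the line can be cut off without losing any.
  have hfar : ∀ S : Set ℂ, S.Finite → (∀ s ∈ S, s.re < 1 / 2) →
      ∀ᶠ ε : ℝ in 𝓝[>] 0, ∀ s ∈ S, s.re < 1 / 2 - ε := by
    intro S hS hlt
    rw [hS.eventually_all]
    intro s hs
    have : Tendsto (fun ε : ℝ => 1 / 2 - ε) (𝓝[>] 0) (𝓝 (1 / 2 - 0)) :=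
      (Continuous.tendsto (by fun_prop) 0).mono_left nhdsWithin_le_nhds
    rw [sub_zero] at this
    exact this.eventually_const_lt (hlt s hs)
  have hlt_r : ∀ᶠ ε : ℝ in 𝓝[>] 0, ε < r := mem_nhdsWithin_of_mem_nhds (Iio_mem_nhds hr)
  obtain ⟨ε, hε1, hε2, hε3, hεr, hε0⟩ := (hline.and ((hfar _ hfin1 fun s hs => hs.1.2).and
    ((hfar _ hfin2 fun s hs => hs.1.2).and (hlt_r.and self_mem_nhdsWithin)))).exists
  replace hε0 : 0 < ε := hε0
  -- The rectangle stays within 3r of s₀, since 2√2 < 3, and three of its sides are at distance at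
  -- least 2r. Its part outside the half-disc lies in the annulus, where neither ζ nor ζ' vanishes.
  set z : ℂ := ⟨1 / 2 - 2 * r, T - 2 * r⟩ with hz
  set w : ℂ := ⟨1 / 2 - ε, T + 2 * r⟩ with hw
  set R : Set ℂ := Icc z.re w.re ×ℂ Icc z.im w.im with hR
  have hmemR : ∀ s, s ∈ R ↔ (1 / 2 - 2 * r ≤ s.re ∧ s.re ≤ 1 / 2 - ε) ∧ (T - 2 * r ≤ s.im ∧ s.im ≤ T + 2 * r) := by
    intro s; rfl
  have hre : ∀ s, |s.re - 1 / 2| ≤ ‖s - s₀‖ := fun s => by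
    simpa [hs0re] using Complex.abs_re_le_norm (s - s₀)
  have him : ∀ s, |s.im - T| ≤ ‖s - s₀‖ := fun s => by
    simpa [hs0im] using Complex.abs_im_le_norm (s - s₀)
  have hRnorm : ∀ s ∈ R, ‖s - s₀‖ ≤ 3 * r := by
    intro s hs
    obtain ⟨⟨a1, a2⟩, a3, a4⟩ := (hmemR s).1 hs
    refine le_of_sq_le_sq ?_ (by positivity)
    rw [Complex.sq_norm, Complex.normSq_apply, Complex.sub_re, Complex.sub_im, hs0re, hs0im]
    nlinarith
  have hRU : R ⊆ {1}ᶜ := by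
    rintro s hs rfl
    have := ((hmemR 1).1 hs).2.1
    simp only [Complex.one_im] at this
    linarith
  have hbd : ∀ s ∈ rectBoundary z w, (deriv riemannZeta s / riemannZeta s).re < 0 := by
    intro s hs
    have hsR : s ∈ R := ⟨hs.1, hs.2.1⟩
    obtain ⟨⟨a1, a2⟩, a3, a4⟩ := (hmemR s).1 hsR
    have hlt : s.re < 1 / 2 := by linarith
    have hann' : 2 * r ≤ ‖s - s₀‖ → (deriv riemannZeta s / riemannZeta s).re < 0 := fun h =>
      hann s hlt (by linarith) (hRnorm s hsR)
    rcases hs.2.2 with h | h | h | h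
    · refine hann' (le_trans ?_ (hre s))
      rw [h, show z.re - 1 / 2 = -(2 * r) by simp [hz], abs_neg]; exact le_abs_self _
    · have hs' : s = 1 / 2 - ε + s.im * Complex.I := by
        apply Complex.ext
        · simp [h, hw]
        · simp
      rw [hs']
      exact hε1 s.im (abs_le.2 ⟨by linarith, by linarith⟩)
    · refine hann' (le_trans ?_ (him s))
      rw [h, show z.im - T = -(2 * r) by simp [hz], abs_neg]; exact le_abs_self _
    · refine hann' (le_trans ?_ (him s))
      rw [h, show w.im - T = 2 * r by simp [hw]]; exact le_abs_self _
  have hcount := zeroCount_eq_of_re_div_neg (z := z) (w := w) (U := {1}ᶜ)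
    (by simp only [hz, hw]; linarith) (by simp only [hz, hw]; linarith) hRU hζ' hζ hζ'fin hζfin hbd
  have hset : ∀ f : ℂ → ℂ, (∀ s ∈ zerosIn f (leftHalfDisc T r), s.re < 1 / 2 - ε) →
      (∀ s, (deriv riemannZeta s / riemannZeta s).re < 0 → f s ≠ 0) →
      zerosIn f (leftHalfDisc T r) = zerosIn f R := by
    intro f hf1 hf2
    ext s
    constructor
    · intro hs
      have h1 := hf1 s hs
      have hs1 : ‖s - s₀‖ ≤ r := hs.1.1
      have h2 := (abs_le.1 ((hre s).trans hs1)).1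
      have h3 := abs_le.1 ((him s).trans hs1)
      exact ⟨(hmemR s).2 ⟨⟨by linarith, h1.le⟩, by linarith [h3.1], by linarith [h3.2]⟩, hs.2⟩
    · intro hs
      have hlt : s.re < 1 / 2 := by linarith [((hmemR s).1 hs.1).1.2]
      refine ⟨⟨?_, hlt⟩, hs.2⟩
      by_contra hcon
      exact hf2 s (hann s hlt (not_le.1 hcon).le (hRnorm s hs.1)) hs.2
  have e1 := hset riemannZeta hε2 fun s hs h0 => by simp [h0] at hs
  have e2 := hset (deriv riemannZeta) hε3 fun s hs h0 => by simp [h0] at hs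
  unfold zeroCount at hcount ⊢
  rw [e1, e2]
  exact hcount.symm

/-! ### Choice of the radius. -/

theorem eventually_rpow_bounds (K : ℝ) :
    ∀ᶠ T : ℝ in atTop, 1000 ≤ T ∧ 5 * Real.log T ≤ T ^ (2 / 1000 : ℝ) ∧
      2 ≤ T ^ (1 / 1000 : ℝ) ∧ 100000 * (1 + K * Real.log T) ≤ Real.exp (T ^ (2 / 1000 : ℝ)) := by
  have h1 : ∀ᶠ T : ℝ in atTop, Real.log T ≤ 1 / 5 * T ^ (2 / 1000 : ℝ) := by
    filter_upwards [(isLittleO_log_rpow_atTop (show (0 : ℝ) < 2 / 1000 by norm_num)).def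
      (show (0 : ℝ) < 1 / 5 by norm_num), eventually_ge_atTop 1] with T hT hT1
    rw [Real.norm_eq_abs, Real.norm_eq_abs, abs_of_nonneg (Real.log_nonneg hT1),
      abs_of_nonneg (by positivity)] at hT
    exact hT
  have h2 := (tendsto_rpow_atTop (show (0 : ℝ) < 1 / 1000 by norm_num)).eventually_ge_atTop 2
  have h3 : ∀ᶠ T : ℝ in atTop, 100000 * (1 + K * Real.log T) ≤ Real.exp (5 * Real.log T) := by
    have h4 : ∀ᶠ x : ℝ in atTop, 100000 * (1 + K * x) ≤ Real.exp (5 * x) := by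
      filter_upwards [eventually_ge_atTop (100000 * (1 + |K|)), eventually_ge_atTop 1] with x hx hx1
      have h5 := Real.quadratic_le_exp_of_nonneg (show 0 ≤ 5 * x by linarith)
      have h6 : K * x ≤ |K| * x := by gcongr; exact le_abs_self K
      have h7 : 100000 * (1 + |K|) * x ≤ x * x := by gcongr
      nlinarith [abs_nonneg K]
    exact Real.tendsto_log_atTop.eventually h4
  filter_upwards [eventually_ge_atTop 1000, h1, h2, h3] with T a1 a2 a3 a4
  exact ⟨a1, by linarith, a3, a4.trans (Real.exp_le_exp.2 (by linarith))⟩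

theorem theorem1 :
    ∃ T₀ : ℝ, 0 < T₀ ∧ ∀ T : ℝ, T₀ < T → ∀ A : ℝ, 0.17 < A →
      ∃ r : ℝ, Real.exp (-(T ^ A)) ≤ r ∧ r ≤ Real.exp (-(T ^ (A - 0.17))) ∧
        (zerosIn riemannZeta (leftHalfDisc T r)).Finite ∧
        (zerosIn (deriv riemannZeta) (leftHalfDisc T r)).Finite ∧
        zeroCount riemannZeta (leftHalfDisc T r) =
          zeroCount (deriv riemannZeta) (leftHalfDisc T r) := by
  obtain ⟨K, T₁, hK0, hT1, hexp⟩ := exists_isLocalExpansion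
  obtain ⟨T₂, hT2⟩ := eventually_atTop.1 (eventually_rpow_bounds K)
  refine ⟨T₁ + |T₂|, by positivity, fun T hT A hA => ?_⟩
  obtain ⟨b1, b2, b3, b4⟩ := hT2 T (by linarith [le_abs_self T₂])
  obtain ⟨Z, Q, hloc, hn⟩ := hexp T (by linarith [abs_nonneg T₂])
  have hT0 : 0 < T := by linarith
  have hT1' : 1 ≤ T := by linarith
  have hA' : 0 < A - 0.17 := by linarith
  set ℓ := Real.log T with hℓ
  have hℓ1 : 1 ≤ ℓ := by
    rw [hℓ, Real.le_log_iff_exp_le hT0]; linarith [Real.exp_one_lt_d9]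
  set s₀ : ℂ := 1 / 2 + Complex.I * T with hs0
  set N := (Z.filter fun a => a.re < 1 / 2).card with hN
  have hNℓ : (N : ℝ) ≤ 235 / 1000 * ℓ := by
    have := hloc.toIsLocalZeros.two_mul_card_left_le
    linarith
  -- The extra 2/1000 keeps L₀ ≥ T^(2/1000) even for A near 0.17, so that exp(−L) beats the factor 1
  -- + K log T and 5 log T ≤ L₀.
  set L₀ := T ^ (A - 0.17 + 2 / 1000) with hL0
  have hL0big : T ^ (2 / 1000 : ℝ) ≤ L₀ := Real.rpow_le_rpow_of_exponent_le hT1' (by linarith)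
  -- With r = exp(−L) and B = log T, the avoided interval for −log |a − s₀| is the range r/T ≤ |a −
  -- s₀| ≤ T√r. Only left zeros need be avoided, as mirror images have the same distance.
  obtain ⟨L, hLlow, hLup, hLgap⟩ := exists_scale_avoiding
    ((Z.filter fun a => a.re < 1 / 2).image fun a => -Real.log ‖a - s₀‖) (B := ℓ) (L₀ := L₀)
    (by linarith) (by positivity)
  have hLA : L ≤ T ^ A := by
    -- Here 0.235 log 2 < 0.163. Together with 0.002 from `L₀` and 0.001 for replacing `L₀ + 5 * ℓ`
    -- by a multiple of `L₀`, the total 0.166 stays below 0.17.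
    have h2N : (2 : ℝ) ^ ((Z.filter fun a => a.re < 1 / 2).image fun a => -Real.log ‖a - s₀‖).card ≤
        T ^ (163 / 1000 : ℝ) := by
      calc (2 : ℝ) ^ ((Z.filter fun a => a.re < 1 / 2).image fun a => -Real.log ‖a - s₀‖).card
          ≤ 2 ^ N := pow_le_pow_right₀ (by norm_num) Finset.card_image_le
        _ = Real.exp (N * Real.log 2) := by
            rw [Real.exp_nat_mul, Real.exp_log (by norm_num)]
        _ ≤ Real.exp (ℓ * (163 / 1000)) := by
            have := Real.log_two_lt_d9
            have h0 := Real.log_two_gt_d9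
            have : (N : ℝ) * Real.log 2 ≤ (235 / 1000 * ℓ) * 0.6931471808 := by gcongr
            refine Real.exp_le_exp.2 ?_
            linarith
        _ = _ := by rw [Real.rpow_def_of_pos hT0]
    calc L ≤ T ^ (163 / 1000 : ℝ) * (L₀ + 5 * ℓ) := hLup.trans (by gcongr)
      _ ≤ T ^ (163 / 1000 : ℝ) * (T ^ (1 / 1000 : ℝ) * L₀) := by
          gcongr
          have : 0 ≤ L₀ := by positivity
          nlinarith
      _ = T ^ (A - 0.004) := by
          rw [hL0, ← Real.rpow_add hT0, ← Real.rpow_add hT0]; congr 1; norm_num; ring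
      _ ≤ T ^ A := Real.rpow_le_rpow_of_exponent_le hT1' (by linarith)
  set r := Real.exp (-L) with hr
  have hr0 : 0 < r := Real.exp_pos _
  have hrsmall : 100000 * (1 + K * ℓ) * r ≤ 1 := by
    have : 100000 * (1 + K * ℓ) ≤ Real.exp L := b4.trans (Real.exp_le_exp.2 (hL0big.trans hLlow))
    calc _ ≤ Real.exp L * r := by gcongr
      _ = 1 := by rw [hr, ← Real.exp_add]; simp
  have hKℓ : 0 ≤ K * ℓ := by positivity
  have hr1 : 100000 * r ≤ 1 := by nlinarith
  have hKr : 100000 * (K * ℓ * r) ≤ 1 := by nlinarith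
  -- D = T√r, so the far zeros cost 48 r/D² · n = 48/T with the crude count n = T.
  set D := T * Real.exp (-L / 2) with hD
  have hsq : Real.exp (-L / 2) ^ 2 = r := by rw [← Real.exp_nat_mul, hr]; congr 1; push_cast; ring
  have hsq0 : 0 < Real.exp (-L / 2) := Real.exp_pos _
  have hD2 : D ^ 2 = T ^ 2 * r := by rw [hD, mul_pow, hsq]
  have hgapleft : ∀ a ∈ Z, a.re < 1 / 2 → ‖a - s₀‖ < r / 3 ∨ D < ‖a - s₀‖ := by
    intro a ha hare
    have hpos : 0 < ‖a - s₀‖ := by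
      refine norm_pos_iff.2 fun h0 => ?_
      have := congrArg Complex.re h0
      simp [hs0] at this
      linarith
    rcases hLgap _ (Finset.mem_image_of_mem _ (Finset.mem_filter.2 ⟨ha, hare⟩)) with h | h
    · right
      rw [hD, ← Real.exp_log hT0, ← Real.exp_add, ← Real.lt_log_iff_exp_lt hpos]
      linarith
    · left
      have : ‖a - s₀‖ < r / T := by
        rw [hr, ← Real.exp_log hT0, ← Real.exp_sub, ← Real.log_lt_iff_lt_exp hpos]
        linarith
      refine this.trans_le ?_
      gcongr
      linarith
  have hgap : ∀ a ∈ Z, a.re ≠ 1 / 2 → ‖a - s₀‖ < r / 3 ∨ D < ‖a - s₀‖ := by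
    intro a ha hare
    rcases lt_or_gt_of_ne hare with h | h
    · exact hgapleft a ha h
    · have := hgapleft _ (hloc.reflect_mem ha) (by simp; linarith)
      rwa [IsLocalZeros.norm_reflect_sub] at this
  refine ⟨r, Real.exp_le_exp.2 (by linarith), Real.exp_le_exp.2 ?_,
    zeroCount_leftHalfDisc_eq hr0 (by linarith) (fun s h1 h2 h3 =>
      hloc.re_logDeriv_neg_of_annulus hKℓ (n := T) (D := D) hr0 (by linarith) ?_ hgap ?_ (by linarith) ?_ h1 h2 h3)
      (hloc.eventually_re_logDeriv_neg (by linarith))⟩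
  · have : T ^ (A - 0.17) ≤ L₀ := Real.rpow_le_rpow_of_exponent_le hT1' (by linarith)
    linarith
  · have h1 : Real.exp (-L / 2) ≤ 1 := by
      by_contra hcon
      nlinarith
    calc 6 * r = 6 * (Real.exp (-L / 2) * Real.exp (-L / 2)) := by rw [← hsq]; ring
      _ ≤ 6 * (1 * Real.exp (-L / 2)) := by gcongr
      _ ≤ D := by rw [hD]; nlinarith
  · have := Real.log_le_sub_one_of_pos hT0
    linarith
  · rw [hD2]
    have : 48 * r / (T ^ 2 * r) * T = 48 / T := by field_simp
    rw [this, div_le_iff₀ hT0]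
    linarith
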